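/- Let $\omega_1,\omega_3\in\mathbb{C}$ be linearly independent over $\mathbb{R}$, let $\wp$ be the Weierstrass function with basic periods $(2\omega_1,2\omega_3)$, and put $\omega_0=0$, $\omega_2=-\omega_1-\omega_3$ and $e_i=\wp(\omega_i)$ for $i=1,2,3$. For integers $l_0,\dots,l_3$ let $$H^{(l_0,l_1,l_2,l_3)}=-\frac{d^2}{dx^2}+\sum_{i=0}^{3}l_i(l_i+1)\,\wp(x+\omega_i).$$ For integers $\alpha_0,\dots,\alpha_3$ such that $d=-\sum_{i=0}^3\alpha_i/2$ is a non-negative integer, let $$L_{\alpha_0,\alpha_1,\alpha_2,\alpha_3}=\wp'(x)^{d+1}\,\widehat\Phi(\wp(x))\circ\Big(\frac{1}{\wp'(x)}\frac{d}{dx}\Big)^{d+1}\circ\widehat\Phi(\wp(x))^{-1},\qquad \widehat\Phi(z)=\prod_{i=1}^{3}(z-e_i)^{\alpha_i/2}$$ (the choice of the branch of $\widehat\Phi(\wp(x))$ is immaterial). For arbitrary integers $\alpha_i$ let $\tilde L_{\alpha_0,\alpha_1,\alpha_2,\alpha_3}$ be $L_{\alpha_0,\alpha_1,\alpha_2,\alpha_3}$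 if $\sum_i\alpha_i/2\in\mathbb{Z}_{\le 0}$, be $L_{1-\alpha_0,1-\alpha_1,1-\alpha_2,1-\alpha_3}$ if $\sum_i\alpha_i/2\in\mathbb{Z}_{\ge 2}$, and be the identity otherwise. Let $l_0,l_1,l_2,l_3$ be non-negative integers. If $l_0+l_1+l_2+l_3$ is even, set $$l_0^e=\tfrac{-l_0+l_1+l_2+l_3}{2},\quad l_1^e=\tfrac{l_0-l_1+l_2+l_3}{2},\quad l_2^e=\tfrac{l_0+l_1-l_2+l_3}{2},\quad l_3^e=\tfrac{l_0+l_1+l_2-l_3}{2},$$ $$\tilde A=\tilde L_{-l_3^e,\,l_2^e+1,\,l_1^e+1,\,-l_0^e}\;\tilde L_{-l_1,\,l_0+1,\,-l_3,\,l_2+1}\;\tilde L_{-l_0^e,\,-l_1^e,\,l_2^e+1,\,l_3^e+1}\;\tilde L_{-l_0,\,-l_1,\,-l_2,\,-l_3}.$$ If $l_0+l_1+l_2+l_3$ is odd, set $$l_0^o=\tfrac{l_0+l_1+l_2+l_3+1}{2},\quad l_1^o=\tfrac{l_0+l_1-l_2-l_3-1}{2},\quad l_2^o=\tfrac{l_0-l_1+l_2-l_3-1}{2},\quad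 l_3^o=\tfrac{l_0-l_1-l_2+l_3-1}{2},$$ $$\tilde A=\tilde L_{l_2^o+1,\,-l_3^o,\,-l_0^o,\,-l_1^o}\;\tilde L_{-l_1,\,-l_0,\,l_3+1,\,-l_2}\;\tilde L_{-l_0^o,\,l_1^o+1,\,-l_2^o,\,-l_3^o}\;\tilde L_{l_0+1,\,-l_1,\,-l_2,\,-l_3}.$$ Let $k_0\ge k_1\ge k_2\ge k_3$ be the decreasing rearrangement of $l_0,\dots,l_3$. If $\sum_i l_i$ is even, put $g=k_0$ if $k_0+k_3\ge k_1+k_2$ and $g=(k_0+k_1+k_2-k_3)/2$ otherwise; if $\sum_i l_i$ is odd, put $g=k_0$ if $k_0\ge k_1+k_2+k_3+1$ and $g=(k_0+k_1+k_2+k_3+1)/2$ otherwise. Then $\tilde A$ commutes with the Hamiltonian, as differential operators: $$\tilde A\,H^{(l_0,l_1,l_2,l_3)}=H^{(l_0,l_1,l_2,l_3)}\,\tilde A,$$ and $\tilde A$ is a monic ordinary differential operator of order $2g+1$ whose coefficients are meromorphic on $\mathbb{C}$ and holomorphic at every $x$ for which $2x$ is not a period of $\wp$. -/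

import Mathlib

/-!
# Generalized Darboux operators for the `BC₁` Inozemtsev Hamiltonian

The Weierstrass function is Mathlib's `PeriodPair.weierstrassP`. The two entries of a `PeriodPair`
are the *full* basic periods, i.e. `P.ω₁ = 2 ω_1` and `P.ω₂ = 2 ω_3`.

Differential operators are realized as maps on functions `ℂ → ℂ`; since they are local and their
coefficients are holomorphic off the half-lattice `{x | 2 x ∈ lattice}`, identities between them are
tested on all functions that are holomorphic near a point outside the half-lattice.
-/

noncomputable section

namespace Inozemtsev

/-- The half-periods `ω_0 = 0`, `ω_1`, `ω_2 = -ω_1 - ω_3`, `ω_3`. -/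
def halfPeriod (P : PeriodPair) : Fin 4 → ℂ :=
  ![0, P.ω₁ / 2, -(P.ω₁ / 2) - P.ω₂ / 2, P.ω₂ / 2]

/-- The values `e_i = ℘(ω_i)` (used for `i = 1, 2, 3` only). -/
def eVal (P : PeriodPair) (i : Fin 4) : ℂ := P.weierstrassP (halfPeriod P i)

/-- The points `x` with `2 x` outside the period lattice. There `℘` and all `℘(x + ω_i)` are
holomorphic, and `℘'` and `℘ - e_i` do not vanish. -/
def regularSet (P : PeriodPair) : Set ℂ := {x | 2 * x ∉ P.lattice}

/-- The Hamiltonian `H^{(l_0,l_1,l_2,l_3)} = -d²/dx² + ∑ l_i (l_i + 1) ℘(x + ω_i)`. -/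
def hamiltonian (P : PeriodPair) (l : Fin 4 → ℤ) (f : ℂ → ℂ) (x : ℂ) : ℂ :=
  -deriv (deriv f) x +
    (∑ i : Fin 4, (l i : ℂ) * ((l i : ℂ) + 1) * P.weierstrassP (x + halfPeriod P i)) * f x

/-- For `w` near `a ≠ 0`: the holomorphic branch of `w ↦ w ^ s` which at `w = a` takes the
principal value. -/
def powBranch (s a w : ℂ) : ℂ := a ^ s * (w / a) ^ s

/-- For `y` near `x`: a holomorphic branch of
`∏_{i=1}^{3} (℘(y) - e_i) ^ (α_i / 2)`. -/
def phiHat (P : PeriodPair) (α : Fin 4 → ℤ) (x y : ℂ) : ℂ :=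
  ∏ i : Fin 3, powBranch ((α i.succ : ℂ) / 2)
    (P.weierstrassP x - eVal P i.succ) (P.weierstrassP y - eVal P i.succ)

/-- The operator `(1 / ℘'(x)) d/dx`. -/
def derivWp (P : PeriodPair) (f : ℂ → ℂ) (x : ℂ) : ℂ :=
  1 / P.derivWeierstrassP x * deriv f x

/-- The operator
`L_α = ℘'(x)^{d+1} Φ(℘(x)) ∘ ((1/℘'(x)) d/dx)^{d+1} ∘ Φ(℘(x))^{-1}`, where
`Φ(z) = ∏_{i=1}^{3} (z - e_i)^{α_i/2}` and `d = -∑ α_i / 2`; it is used only if `d` is a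
non-negative integer. The value at `x` is computed with a branch of `Φ(℘(·))` near `x`;
all branches give the same value, as they differ by constant factors. -/
def darboux (P : PeriodPair) (α : Fin 4 → ℤ) (f : ℂ → ℂ) (x : ℂ) : ℂ :=
  let d : ℕ := (-(∑ i, α i) / 2).toNat
  P.derivWeierstrassP x ^ (d + 1) * phiHat P α x x *
    ((derivWp P)^[d + 1] (fun y => (phiHat P α x y)⁻¹ * f y)) x

/-- The operator `L̃_α`: it is `L_α` if `∑ α_i / 2` is an integer `≤ 0`, it is `L_{1-α}` if
`∑ α_i / 2` is an integer `≥ 2`, and it is the identity otherwise. -/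
def darbouxTilde (P : PeriodPair) (α : Fin 4 → ℤ) : (ℂ → ℂ) → (ℂ → ℂ) :=
  if Even (∑ i, α i) ∧ (∑ i, α i) / 2 ≤ 0 then darboux P α
  else if Even (∑ i, α i) ∧ 2 ≤ (∑ i, α i) / 2 then darboux P (fun i => 1 - α i)
  else id

/-- The numbers `l_i^e`; used only if `∑ l_i` is even, when the divisions are exact. -/
def lEven (l : Fin 4 → ℕ) : Fin 4 → ℤ :=
  ![(-l 0 + l 1 + l 2 + l 3) / 2, (l 0 - l 1 + l 2 + l 3) / 2,
    (l 0 + l 1 - l 2 + l 3) / 2, (l 0 + l 1 + l 2 - l 3) / 2]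

/-- The numbers `l_i^o`; used only if `∑ l_i` is odd, when the divisions are exact. -/
def lOdd (l : Fin 4 → ℕ) : Fin 4 → ℤ :=
  ![(l 0 + l 1 + l 2 + l 3 + 1) / 2, (l 0 + l 1 - l 2 - l 3 - 1) / 2,
    (l 0 - l 1 + l 2 - l 3 - 1) / 2, (l 0 - l 1 - l 2 + l 3 - 1) / 2]

/-- The composition `Ã` of four operators `L̃`. -/
def commutingOp (P : PeriodPair) (l : Fin 4 → ℕ) : (ℂ → ℂ) → (ℂ → ℂ) :=
  if Even (∑ i, l i) then
    darbouxTilde P ![-lEven l 3, lEven l 2 + 1, lEven l 1 + 1, -lEven l 0] ∘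
    darbouxTilde P ![-l 1, l 0 + 1, -l 3, l 2 + 1] ∘
    darbouxTilde P ![-lEven l 0, -lEven l 1, lEven l 2 + 1, lEven l 3 + 1] ∘
    darbouxTilde P ![-l 0, -l 1, -l 2, -l 3]
  else
    darbouxTilde P ![lOdd l 2 + 1, -lOdd l 3, -lOdd l 0, -lOdd l 1] ∘
    darbouxTilde P ![-l 1, -l 0, l 3 + 1, -l 2] ∘
    darbouxTilde P ![-lOdd l 0, lOdd l 1 + 1, -lOdd l 2, -lOdd l 3] ∘
    darbouxTilde P ![l 0 + 1, -l 1, -l 2, -l 3]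

/-- The rearrangement `k_0 ≥ k_1 ≥ k_2 ≥ k_3` of `l_0, l_1, l_2, l_3`
(`Tuple.sort` sorts increasingly). -/
def descSort (l : Fin 4 → ℕ) (i : Fin 4) : ℕ := l (Tuple.sort l i.rev)

/-- The number `g`. -/
def genus (l : Fin 4 → ℕ) : ℕ :=
  let k := descSort l
  if Even (∑ i, l i) then
    if k 1 + k 2 ≤ k 0 + k 3 then k 0 else (k 0 + k 1 + k 2 - k 3) / 2
  else
    if k 1 + k 2 + k 3 + 1 ≤ k 0 then k 0 else (k 0 + k 1 + k 2 + k 3 + 1) / 2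

/-- Two operators are equal as differential operators on the open set `U`: at every point of `U`
they agree on every function that is holomorphic near that point. -/
def OpEqOn (U : Set ℂ) (S T : (ℂ → ℂ) → (ℂ → ℂ)) : Prop :=
  ∀ x ∈ U, ∀ f : ℂ → ℂ, AnalyticAt ℂ f x → S f x = T f x

/-- `T` is a monic ordinary differential operator of order `n` on the open set `U`, with
coefficients that are holomorphic on `U` and meromorphic on `ℂ`. -/
def IsMonicDiffOpOn (U : Set ℂ) (n : ℕ) (T : (ℂ → ℂ) → (ℂ → ℂ)) : Prop :=
  ∃ c : Fin n → ℂ → ℂ, (∀ i, AnalyticOnNhd ℂ (c i) U ∧ Meromorphic (c i)) ∧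
    OpEqOn U T (fun f x => iteratedDeriv n f x + ∑ i : Fin n, c i x * iteratedDeriv i f x)

end Inozemtsev

end

/-! Put z = ℘(x). Since ℘(x + ω_i) is a Möbius function of z, conjugating H by Φ = ∏ (z -
e_i)^(α_i/2), with α_i equal to -l_i or l_i + 1, turns it into a Heun operator -(A ∇² + B ∇ + C).
Here ∇ is the conjugate of d/dz, and A, B, C are polynomials in z of degree at most 3, 2, 1
(`hamiltonian_eq_heun`).

Apply ∇^(m+1). By the Leibniz rule the degree bounds leave only the terms in ∇^(m+3), ..., ∇^m, and
the last coefficient is a constant with factor ∑ α_i + 2m. When ∑ α_i = -2m it vanishes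
(`heun_quasi_solvable`), and what remains is a Heun operator acting on ∇^(m+1) f, with α_i replaced
by α_i + m + 1. Multiplication by ℘'^(m+1), a constant times ∏ (z - e_i)^((m+1)/2), is exactly the
matching change of gauge. Hence L_α carries H^(l) to some H^(l') (`gaugePow_hamiltonian`). Up to l ↦
-l - 1, which leaves H unchanged, l'_i is α_i - ∑ α_j / 2, and this also covers both other cases of
L̃ (`intertwines_darbouxTilde`).

The four factors of Ã then form a closed chain of Hamiltonians that returns to l
(`intertwines_commutingOp`), which gives commutation. A factor with ∑ α_i = 2s has order |1 - s|.
Orders add under composition, and the sum of the four is a symmetric function of l, which on sorted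
arguments equals 2g + 1 (`genus_even`, `genus_odd`). -/

noncomputable section

namespace Inozemtsev

open Filter Topology

/-! ### Translation of ℘ by a half-period -/

section

variable (P : PeriodPair)

theorem weierstrassP_add_of_mem (z : ℂ) {l : ℂ} (hl : l ∈ P.lattice) :
    P.weierstrassP (z + l) = P.weierstrassP z :=
  P.weierstrassP_add_coe z ⟨l, hl⟩

theorem add_mem_lattice_iff {x l : ℂ} (hl : l ∈ P.lattice) :
    x + l ∈ P.lattice ↔ x ∈ P.lattice :=
  P.lattice.toAddSubgroup.add_mem_cancel_right hl

theorem mem_lattice_add_iff {x w : ℂ} (hw : 2 * w ∈ P.lattice) :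
    x + w + w ∈ P.lattice ↔ x ∈ P.lattice := by
  rw [show x + w + w = x + 2 * w by ring, add_mem_lattice_iff P hw]

theorem derivWeierstrassP_half {w : ℂ} (hw : 2 * w ∈ P.lattice) :
    P.derivWeierstrassP w = 0 := by
  have h := P.derivWeierstrassP_add_coe (-w) ⟨2 * w, hw⟩
  simp only [P.derivWeierstrassP_neg] at h
  rw [show -w + 2 * w = w by ring] at h
  exact CharZero.eq_neg_self_iff.mp h

/-- The zero is at least double because ℘' is odd and periodic, so it vanishes at `w`. -/
theorem exists_weierstrassP_add_half {w : ℂ} (hw : 2 * w ∈ P.lattice) (hw' : w ∉ P.lattice) :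
    ∃ g : ℂ → ℂ, AnalyticAt ℂ g 0 ∧
      ∀ᶠ x in 𝓝 0, P.weierstrassP (x + w) - P.weierstrassP w = x ^ 2 * g x := by
  have hA : AnalyticAt ℂ P.weierstrassP (0 + w) := by
    simpa using P.analyticOnNhd_weierstrassP w hw'
  have hB : AnalyticAt ℂ (fun x => P.weierstrassP (x + w) - P.weierstrassP w) 0 :=
    (hA.fun_comp (f := fun x => x + w) (by fun_prop)).sub analyticAt_const
  have h2 : ((2 : ℕ) : ℕ∞) ≤
      analyticOrderAt (fun x => P.weierstrassP (x + w) - P.weierstrassP w) 0 := by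
    rw [natCast_le_analyticOrderAt_iff_iteratedDeriv_eq_zero hB]
    intro i hi
    interval_cases i
    · simp
    · simp [iteratedDeriv_one, deriv_comp_add_const, derivWeierstrassP_half P hw]
  rw [natCast_le_analyticOrderAt hB] at h2
  simpa using h2

theorem exists_weierstrassP_zero :
    ∃ h : ℂ → ℂ, AnalyticAt ℂ h 0 ∧
      ∀ x, P.weierstrassP x = h x + 1 / x ^ 2 := by
  refine ⟨P.weierstrassPExcept 0, P.analyticAt_weierstrassPExcept 0, fun x => ?_⟩
  have := P.weierstrassPExcept_add 0 x
  simpa using this.symm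

/-- The complement of the countable lattice is connected, so by the identity theorem ℘ would be
constant there, against its pole at 0. -/
theorem weierstrassP_not_locally_const {w : ℂ} (hw : w ∉ P.lattice) (c : ℂ) :
    ¬ ∀ᶠ x in 𝓝 w, P.weierstrassP x = c := by
  intro h
  have hc : (P.lattice : Set ℂ).Countable := by
    have : Countable P.lattice := P.latticeEquivProd.toEquiv.countable_iff.mpr inferInstance
    exact Set.to_countable _
  have hconn : IsPreconnected ((P.lattice : Set ℂ)ᶜ) :=
    (hc.isPathConnected_compl_of_one_lt_rank (by simp)).isConnected.isPreconnected
  have heq := P.analyticOnNhd_weierstrassP.eqOn_of_preconnected_of_eventuallyEq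
    (analyticOnNhd_const (v := c)) hconn hw h
  have h0 := P.order_weierstrassP 0 (zero_mem _)
  have h1 : P.weierstrassP =ᶠ[𝓝[≠] 0] fun _ => c := by
    filter_upwards [self_mem_nhdsWithin, mem_nhdsWithin_of_mem_nhds
      (P.compl_lattice_sdiff_singleton_mem_nhds 0)] with z hz hz'
    exact heq (by simp_all)
  rw [meromorphicOrderAt_congr h1] at h0
  have h2 := (analyticAt_const (𝕜 := ℂ) (v := c) (x := (0 : ℂ))).meromorphicOrderAt_nonneg
  rw [h0] at h2
  exact absurd h2 (by decide)

/-- The double pole of one factor meets a double zero of the other, so the product extends to an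
entire elliptic function, and Liouville's theorem applies. -/
theorem exists_half_period_const {w : ℂ} (hw : 2 * w ∈ P.lattice) (hw' : w ∉ P.lattice) :
    ∃ c : ℂ, c ≠ 0 ∧ ∀ x, x ∉ P.lattice → x + w ∉ P.lattice →
      (P.weierstrassP x - P.weierstrassP w) * (P.weierstrassP (x + w) - P.weierstrassP w) = c := by
  classical
  obtain ⟨g, hg, hgw⟩ := exists_weierstrassP_add_half P hw hw'
  obtain ⟨h, hh, hh0⟩ := exists_weierstrassP_zero P
  -- `g 0` is the limit of the product at 0. Invariance under the lattice and under `w` carries it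
  -- to every removable singularity.
  set F : ℂ → ℂ := fun x => if x ∈ P.lattice ∨ x + w ∈ P.lattice then g 0 else
    (P.weierstrassP x - P.weierstrassP w) * (P.weierstrassP (x + w) - P.weierstrassP w) with hF
  have hFw (x : ℂ) : F (x + w) = F x := by
    simp only [hF, mem_lattice_add_iff P hw]
    rw [show x + w + w = x + 2 * w by ring, weierstrassP_add_of_mem P x hw]
    simp only [or_comm, mul_comm]
  have hFl (x l : ℂ) (hl : l ∈ P.lattice) : F (x + l) = F x := by
    simp only [hF]
    rw [show x + l + w = x + w + l by ring, weierstrassP_add_of_mem P x hl,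
      weierstrassP_add_of_mem P (x + w) hl, add_mem_lattice_iff P hl, add_mem_lattice_iff P hl]
  have hF0 : ∀ᶠ x in 𝓝 0, F x = g x * (1 + x ^ 2 * (h x - P.weierstrassP w)) := by
    have hcl : ∀ᶠ x in 𝓝 (0 : ℂ), x + w ∉ P.lattice := by
      have : ContinuousAt (fun x : ℂ => x + w) 0 := by fun_prop
      exact this.eventually_mem (P.isClosed_lattice.isOpen_compl.mem_nhds (by simpa using hw'))
    filter_upwards [hgw, P.compl_lattice_sdiff_singleton_mem_nhds 0, hcl] with x hx hx1 hx2
    by_cases hx0 : x = 0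
    · simp [hF, hx0]
    · have : x ∉ P.lattice := by simp_all
      simp only [hF, this, hx2, or_self, if_false]
      rw [hx, hh0 x]
      field_simp
      ring
  have hFa0 : AnalyticAt ℂ F 0 := by
    refine AnalyticAt.congr (f := fun x => g x * (1 + x ^ 2 * (h x - P.weierstrassP w))) ?_
      (hF0.mono fun x hx => hx.symm)
    fun_prop
  have hFal (l : ℂ) (hl : l ∈ P.lattice) : AnalyticAt ℂ F l := by
    have h1 : AnalyticAt ℂ (fun x => F (x + -l)) l :=
      AnalyticAt.fun_comp (g := F) (f := fun x => x + -l) (by simpa using hFa0) (by fun_prop)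
    exact h1.congr (Eventually.of_forall fun x => hFl x (-l) (neg_mem hl))
  have hFa (x : ℂ) : AnalyticAt ℂ F x := by
    by_cases h1 : x ∈ P.lattice
    · exact hFal x h1
    by_cases h2 : x + w ∈ P.lattice
    · exact ((hFal _ h2).fun_comp (f := fun y => y + w) (by fun_prop)).congr
        (Eventually.of_forall hFw)
    have hcl : ∀ᶠ y in 𝓝 x, y + w ∉ P.lattice := by
      have : ContinuousAt (fun y : ℂ => y + w) x := by fun_prop
      exact this.eventually_mem (P.isClosed_lattice.isOpen_compl.mem_nhds h2)
    have hA := P.analyticOnNhd_weierstrassP x h1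
    have hB := (P.analyticOnNhd_weierstrassP (x + w) h2).fun_comp (f := fun y => y + w)
      (by fun_prop)
    refine ((hA.sub (analyticAt_const (v := P.weierstrassP w))).mul
      (hB.sub (analyticAt_const (v := P.weierstrassP w)))).congr ?_
    filter_upwards [P.isClosed_lattice.isOpen_compl.mem_nhds h1, hcl] with y hy1 hy2
    have : y ∉ P.lattice := hy1
    simp [hF, this, hy2]
  have hFd : Differentiable ℂ F := fun x => (hFa x).differentiableAt
  have hconst (x : ℂ) : F x = F 0 :=
    hFd.apply_eq_apply_of_bounded (IsZLattice.isCompact_range_of_periodic P.lattice _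
      hFd.continuous fun z w hw ↦ hFl z w hw).isBounded x 0
  refine ⟨F 0, fun h0 => ?_, fun x hx1 hx2 => ?_⟩
  -- If the constant were 0, then `g` would vanish near 0 and ℘ would be constant near `w`.
  · have hne : ∀ᶠ x in 𝓝 (0 : ℂ), 1 + x ^ 2 * (h x - P.weierstrassP w) ≠ 0 := by
      have : ContinuousAt (fun x => 1 + x ^ 2 * (h x - P.weierstrassP w)) 0 := by
        have := hh.continuousAt
        fun_prop
      exact this.eventually_ne (by simp)
    have hloc : ∀ᶠ x in 𝓝 (0 : ℂ), P.weierstrassP (x + w) = P.weierstrassP w := by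
      filter_upwards [hne, hF0, hgw] with x hx1 hx2 hx3
      rw [hconst, h0, eq_comm, mul_eq_zero] at hx2
      rw [hx2.resolve_right hx1, mul_zero, sub_eq_zero] at hx3
      exact hx3
    refine weierstrassP_not_locally_const P hw' (P.weierstrassP w) ?_
    have ht : Tendsto (fun y : ℂ => y - w) (𝓝 w) (𝓝 0) := by
      have : ContinuousAt (fun y : ℂ => y - w) w := by fun_prop
      simpa [ContinuousAt] using this
    filter_upwards [ht.eventually hloc] with y hy
    simpa using hy
  · rw [← hconst x]
    simp [hF, hx1, hx2]

end

/-! ### The values e_i and the differential equations of ℘ -/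

section

variable (P : PeriodPair)

theorem two_mul_halfPeriod_mem (i : Fin 4) : 2 * halfPeriod P i ∈ P.lattice := by
  have h1 := P.ω₁_mem_lattice
  have h2 := P.ω₂_mem_lattice
  fin_cases i
  · simp [halfPeriod]
  · simpa [halfPeriod, mul_div_cancel₀] using h1
  · have := sub_mem (neg_mem h1) h2
    convert this using 1
    simp [halfPeriod]
    ring
  · simpa [halfPeriod, mul_div_cancel₀] using h2

theorem halfPeriod_notMem {i : Fin 4} (hi : i ≠ 0) : halfPeriod P i ∉ P.lattice := by
  fin_cases i
  · simp at hi
  · exact P.ω₁_div_two_notMem_lattice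
  · intro h
    have h1 := (P.mul_ω₁_add_mul_ω₂_mem_lattice (α := -1 / 2) (β := -1 / 2)).mp (by
      convert h using 1
      simp [halfPeriod]
      ring)
    norm_num at h1
  · exact P.ω₂_div_two_notMem_lattice

theorem notMem_lattice_of_mem_regularSet {x : ℂ} (hx : x ∈ regularSet P) : x ∉ P.lattice := by
  intro h
  apply hx
  rw [two_mul]
  exact add_mem h h

theorem add_halfPeriod_notMem {x : ℂ} (hx : x ∈ regularSet P) (i : Fin 4) :
    x + halfPeriod P i ∉ P.lattice := by
  intro h
  apply hx
  have := sub_mem (add_mem h h) (two_mul_halfPeriod_mem P i)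
  convert this using 1
  ring

theorem isOpen_regularSet : IsOpen (regularSet P) :=
  P.isClosed_lattice.isOpen_compl.preimage (f := fun x : ℂ => 2 * x) (by fun_prop)

/-- The constant of `exists_half_period_const` is evaluated at ω_j, where evenness of ℘ gives ℘(ω_j
+ ω_i) = e_k. Both inequalities hold because this constant is nonzero. -/
theorem eVal_ne_and_shift {i j k : Fin 4} (hi : i ≠ 0) (hj : j ≠ 0)
    (hijk : halfPeriod P j + halfPeriod P i = -halfPeriod P k) (hk : k ≠ 0) :
    eVal P j ≠ eVal P i ∧ ∀ x ∈ regularSet P, P.weierstrassP x - eVal P i ≠ 0 ∧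
      (P.weierstrassP x - eVal P i) * (P.weierstrassP (x + halfPeriod P i) - eVal P i) =
        (eVal P j - eVal P i) * (eVal P k - eVal P i) := by
  obtain ⟨c, hc, h⟩ := exists_half_period_const P (two_mul_halfPeriod_mem P i)
    (halfPeriod_notMem P hi)
  have hc' := h (halfPeriod P j) (halfPeriod_notMem P hj)
    (by rw [hijk, neg_mem_iff]; exact halfPeriod_notMem P hk)
  rw [hijk, P.weierstrassP_neg] at hc'
  refine ⟨fun h0 => hc ?_, fun x hx => ?_⟩
  · simp only [eVal] at h0
    rw [← hc', h0, sub_self, zero_mul]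
  have hx' := h x (notMem_lattice_of_mem_regularSet P hx) (add_halfPeriod_notMem P hx i)
  simp only [eVal]
  rw [hx', hc']
  refine ⟨fun h0 => hc ?_, rfl⟩
  rw [← hx', h0, zero_mul]

theorem halfPeriod_one_add_two : halfPeriod P 1 + halfPeriod P 2 = -halfPeriod P 3 := by
  simp [halfPeriod]
  ring

theorem halfPeriod_two_add_three : halfPeriod P 2 + halfPeriod P 3 = -halfPeriod P 1 := by
  simp [halfPeriod]

theorem halfPeriod_three_add_one : halfPeriod P 3 + halfPeriod P 1 = -halfPeriod P 2 := by
  simp [halfPeriod]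

theorem eVal_ne :
    eVal P 1 ≠ eVal P 2 ∧ eVal P 2 ≠ eVal P 3 ∧ eVal P 3 ≠ eVal P 1 :=
  ⟨(eVal_ne_and_shift P (by decide) (by decide) (halfPeriod_one_add_two P) (by decide)).1,
    (eVal_ne_and_shift P (by decide) (by decide) (halfPeriod_two_add_three P) (by decide)).1,
    (eVal_ne_and_shift P (by decide) (by decide) (halfPeriod_three_add_one P) (by decide)).1⟩

section regular

variable {P} {x : ℂ}

theorem weierstrassP_sub_one_ne (hx : x ∈ regularSet P) : P.weierstrassP x - eVal P 1 ≠ 0 :=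
  ((eVal_ne_and_shift P (by decide) (by decide) (halfPeriod_three_add_one P) (by decide)).2 x hx).1

theorem weierstrassP_sub_two_ne (hx : x ∈ regularSet P) : P.weierstrassP x - eVal P 2 ≠ 0 :=
  ((eVal_ne_and_shift P (by decide) (by decide) (halfPeriod_one_add_two P) (by decide)).2 x hx).1

theorem weierstrassP_sub_three_ne (hx : x ∈ regularSet P) : P.weierstrassP x - eVal P 3 ≠ 0 :=
  ((eVal_ne_and_shift P (by decide) (by decide) (halfPeriod_two_add_three P) (by decide)).2 x hx).1

theorem weierstrassP_add_one (hx : x ∈ regularSet P) :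
    P.weierstrassP (x + halfPeriod P 1) = eVal P 1 +
      (eVal P 3 - eVal P 1) * (eVal P 2 - eVal P 1) / (P.weierstrassP x - eVal P 1) := by
  have h := ((eVal_ne_and_shift P (by decide) (by decide) (halfPeriod_three_add_one P)
    (by decide)).2 x hx)
  rw [← h.2, mul_div_cancel_left₀ _ h.1]
  ring

theorem weierstrassP_add_two (hx : x ∈ regularSet P) :
    P.weierstrassP (x + halfPeriod P 2) = eVal P 2 +
      (eVal P 1 - eVal P 2) * (eVal P 3 - eVal P 2) / (P.weierstrassP x - eVal P 2) := by
  have h := ((eVal_ne_and_shift P (by decide) (by decide) (halfPeriod_one_add_two P)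
    (by decide)).2 x hx)
  rw [← h.2, mul_div_cancel_left₀ _ h.1]
  ring

theorem weierstrassP_add_three (hx : x ∈ regularSet P) :
    P.weierstrassP (x + halfPeriod P 3) = eVal P 3 +
      (eVal P 2 - eVal P 3) * (eVal P 1 - eVal P 3) / (P.weierstrassP x - eVal P 3) := by
  have h := ((eVal_ne_and_shift P (by decide) (by decide) (halfPeriod_two_add_three P)
    (by decide)).2 x hx)
  rw [← h.2, mul_div_cancel_left₀ _ h.1]
  ring

end regular

theorem eVal_cubic {i : Fin 4} (hi : i ≠ 0) :
    4 * eVal P i ^ 3 - P.g₂ * eVal P i - P.g₃ = 0 := by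
  rw [eVal, ← P.derivWeierstrassP_sq _ (halfPeriod_notMem P hi),
    derivWeierstrassP_half P (two_mul_halfPeriod_mem P i)]
  simp

theorem eVal_sum : eVal P 1 + eVal P 2 + eVal P 3 = 0 := by
  have h1 := eVal_cubic P (i := 1) (by decide)
  have h2 := eVal_cubic P (i := 2) (by decide)
  have h3 := eVal_cubic P (i := 3) (by decide)
  obtain ⟨h12, h23, h31⟩ := eVal_ne P
  -- In this combination of the three cubic equations the g₂ and g₃ terms cancel, and the cubes sum
  -- to minus the Vandermonde product times the sum of the e_i.
  have a : (eVal P 1 - eVal P 2) * (eVal P 2 - eVal P 3) * (eVal P 3 - eVal P 1) *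
      (eVal P 1 + eVal P 2 + eVal P 3) = 0 := by
    linear_combination (-1 / 4 : ℂ) * ((eVal P 2 - eVal P 3) * h1 + (eVal P 3 - eVal P 1) * h2 +
      (eVal P 1 - eVal P 2) * h3)
  simpa [sub_eq_zero, h12, h23, h31] using a

theorem derivWeierstrassP_sq_eq_prod {x : ℂ} (hx : x ∉ P.lattice) :
    P.derivWeierstrassP x ^ 2 = 4 * (P.weierstrassP x - eVal P 1) *
      (P.weierstrassP x - eVal P 2) * (P.weierstrassP x - eVal P 3) := by
  have h1 := eVal_cubic P (i := 1) (by decide)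
  have h2 := eVal_cubic P (i := 2) (by decide)
  have h3 : eVal P 3 = -eVal P 1 - eVal P 2 := by linear_combination eVal_sum P
  have h12 : eVal P 1 - eVal P 2 ≠ 0 := sub_ne_zero.mpr (eVal_ne P).1
  rw [P.derivWeierstrassP_sq x hx, h3]
  apply mul_left_cancel₀ h12
  linear_combination (P.weierstrassP x - eVal P 2) * h1 - (P.weierstrassP x - eVal P 1) * h2

section regular

variable {P} {x : ℂ}

theorem derivWeierstrassP_ne (hx : x ∈ regularSet P) : P.derivWeierstrassP x ≠ 0 := by
  have h := derivWeierstrassP_sq_eq_prod P (notMem_lattice_of_mem_regularSet P hx)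
  intro h0
  rw [h0] at h
  simp [weierstrassP_sub_one_ne hx, weierstrassP_sub_two_ne hx,
    weierstrassP_sub_three_ne hx] at h

theorem analyticAt_weierstrassP (hx : x ∈ regularSet P) : AnalyticAt ℂ P.weierstrassP x :=
  P.analyticOnNhd_weierstrassP x (notMem_lattice_of_mem_regularSet P hx)

theorem analyticAt_derivWeierstrassP (hx : x ∈ regularSet P) :
    AnalyticAt ℂ P.derivWeierstrassP x :=
  P.analyticOnNhd_derivWeierstrassP x (notMem_lattice_of_mem_regularSet P hx)

theorem hasDerivAt_weierstrassP (hx : x ∈ regularSet P) :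
    HasDerivAt P.weierstrassP (P.derivWeierstrassP x) x := by
  rw [← P.deriv_weierstrassP]
  exact (analyticAt_weierstrassP hx).differentiableAt.hasDerivAt

/-- Differentiate the factorised equation for ℘'² and cancel 2℘'. -/
theorem deriv_derivWeierstrassP (hx : x ∈ regularSet P) :
    deriv P.derivWeierstrassP x =
      2 * ((P.weierstrassP x - eVal P 2) * (P.weierstrassP x - eVal P 3) +
        (P.weierstrassP x - eVal P 1) * (P.weierstrassP x - eVal P 3) +
        (P.weierstrassP x - eVal P 1) * (P.weierstrassP x - eVal P 2)) := by
  have hp := hasDerivAt_weierstrassP hx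
  have hq := (analyticAt_derivWeierstrassP hx).differentiableAt.hasDerivAt
  have h1 := hq.pow 2
  have h2 := ((((hp.sub_const (eVal P 1)).const_mul 4).mul (hp.sub_const (eVal P 2))).mul
    (hp.sub_const (eVal P 3)))
  have h3 := h1.unique (h2.congr_of_eventuallyEq (by
    filter_upwards [(isOpen_regularSet P).mem_nhds hx] with y hy
    simpa using derivWeierstrassP_sq_eq_prod P (notMem_lattice_of_mem_regularSet P hy)))
  apply mul_left_cancel₀ (derivWeierstrassP_ne hx)
  apply mul_left_cancel₀ (two_ne_zero (α := ℂ))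
  simp only [Pi.mul_apply] at h3
  norm_num at h3
  linear_combination h3

end regular

end

/-! ### The gauged derivation ∇ and the operator L_α as ℘'^n ∇^n -/

section

/-- The logarithmic derivative, with respect to `z = ℘(x)`, of `∏ (z - e_i) ^ (α_i / 2)`. -/
def gaugeLog (P : PeriodPair) (α : Fin 4 → ℤ) (x : ℂ) : ℂ :=
  ∑ i : Fin 3, (α i.succ : ℂ) / 2 / (P.weierstrassP x - eVal P i.succ)

/-- The conjugate of `(1 / ℘') d/dx` by `∏ (℘ - e_i) ^ (α_i / 2)`. -/
def gaugeDeriv (P : PeriodPair) (α : Fin 4 → ℤ) (f : ℂ → ℂ) (x : ℂ) : ℂ :=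
  1 / P.derivWeierstrassP x * deriv f x - gaugeLog P α x * f x

variable {P : PeriodPair} {α : Fin 4 → ℤ} {x : ℂ} {f g : ℂ → ℂ}

theorem weierstrassP_sub_eVal_ne (hx : x ∈ regularSet P) (i : Fin 3) :
    P.weierstrassP x - eVal P i.succ ≠ 0 := by
  fin_cases i
  · exact weierstrassP_sub_one_ne hx
  · exact weierstrassP_sub_two_ne hx
  · exact weierstrassP_sub_three_ne hx

theorem eventually_mem_regularSet (hx : x ∈ regularSet P) : ∀ᶠ y in 𝓝 x, y ∈ regularSet P :=
  (isOpen_regularSet P).mem_nhds hx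

theorem analyticAt_gaugeLog (hx : x ∈ regularSet P) : AnalyticAt ℂ (gaugeLog P α) x := by
  unfold gaugeLog
  refine Finset.analyticAt_fun_sum _ fun i _ => ?_
  exact analyticAt_const.div ((analyticAt_weierstrassP hx).sub analyticAt_const)
    (weierstrassP_sub_eVal_ne hx i)

theorem analyticAt_gaugeDeriv (hx : x ∈ regularSet P) (hf : AnalyticAt ℂ f x) :
    AnalyticAt ℂ (gaugeDeriv P α f) x :=
  ((analyticAt_const.div (analyticAt_derivWeierstrassP hx) (derivWeierstrassP_ne hx)).mul
    hf.deriv).sub ((analyticAt_gaugeLog hx).mul hf)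

theorem analyticAt_gaugeDeriv_iterate (hx : x ∈ regularSet P) (hf : AnalyticAt ℂ f x) (k : ℕ) :
    AnalyticAt ℂ ((gaugeDeriv P α)^[k] f) x := by
  induction k with
  | zero => simpa
  | succ k ih =>
    rw [Function.iterate_succ_apply']
    exact analyticAt_gaugeDeriv hx ih

theorem gaugeDeriv_congr (h : f =ᶠ[𝓝 x] g) : gaugeDeriv P α f =ᶠ[𝓝 x] gaugeDeriv P α g := by
  filter_upwards [h, h.deriv] with y hy hy'
  simp [gaugeDeriv, hy, hy']

theorem derivWp_congr (h : f =ᶠ[𝓝 x] g) : derivWp P f =ᶠ[𝓝 x] derivWp P g := by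
  filter_upwards [h.deriv] with y hy'
  simp [derivWp, hy']

theorem deriv_eq_gaugeDeriv (hx : x ∈ regularSet P) (f : ℂ → ℂ) :
    deriv f x = P.derivWeierstrassP x * (gaugeDeriv P α f x + gaugeLog P α x * f x) := by
  have := derivWeierstrassP_ne hx
  simp only [gaugeDeriv]
  field_simp
  ring

theorem hasDerivAt_powBranch (s : ℂ) {a w : ℂ} (ha : a ≠ 0) (hw : w / a ∈ Complex.slitPlane) :
    HasDerivAt (powBranch s a) (powBranch s a w * (s / w)) w := by
  have h0 : w / a ≠ 0 := Complex.slitPlane_ne_zero hw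
  have hw0 : w ≠ 0 := (div_ne_zero_iff.mp h0).1
  have h := (((hasDerivAt_id w).div_const a).cpow_const (c := s) hw).const_mul (a ^ s)
  refine h.congr_deriv ?_
  simp only [id, powBranch]
  rw [Complex.cpow_sub _ _ h0, Complex.cpow_one]
  field_simp

theorem powBranch_ne (s : ℂ) {a w : ℂ} (ha : a ≠ 0) (hw : w ≠ 0) : powBranch s a w ≠ 0 := by
  simp [powBranch, Complex.cpow_eq_zero_iff, ha, hw]

theorem phiHat_ne {y : ℂ} (hx : x ∈ regularSet P) (hy : y ∈ regularSet P) :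
    phiHat P α x y ≠ 0 :=
  Finset.prod_ne_zero_iff.mpr fun i _ =>
    powBranch_ne _ (weierstrassP_sub_eVal_ne hx i) (weierstrassP_sub_eVal_ne hy i)

theorem eventually_hasDerivAt_phiHat (hx : x ∈ regularSet P) :
    ∀ᶠ y in 𝓝 x, HasDerivAt (phiHat P α x)
      (phiHat P α x y * (gaugeLog P α y * P.derivWeierstrassP y)) y := by
  have hslit (i : Fin 3) : ∀ᶠ y in 𝓝 x, (P.weierstrassP y - eVal P i.succ) /
      (P.weierstrassP x - eVal P i.succ) ∈ Complex.slitPlane := by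
    have hc : ContinuousAt (fun y => (P.weierstrassP y - eVal P i.succ) /
        (P.weierstrassP x - eVal P i.succ)) x := by
      have := (analyticAt_weierstrassP hx).continuousAt
      fun_prop
    refine hc.eventually_mem (Complex.isOpen_slitPlane.mem_nhds ?_)
    rw [div_self (weierstrassP_sub_eVal_ne hx i)]
    exact Complex.one_mem_slitPlane
  filter_upwards [eventually_all.mpr hslit, eventually_mem_regularSet hx] with y hy hyU
  have h (i : Fin 3) := (hasDerivAt_powBranch ((α i.succ : ℂ) / 2)
    (weierstrassP_sub_eVal_ne hx i) (hy i)).comp y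
    ((hasDerivAt_weierstrassP hyU).sub_const (eVal P i.succ))
  have hp := HasDerivAt.fun_finsetProd (u := Finset.univ) fun i _ => h i
  refine hp.congr_deriv ?_
  simp only [phiHat, gaugeLog, Fin.sum_univ_three, Fin.prod_univ_three, smul_eq_mul,
    Function.comp]
  simp [show (Finset.univ : Finset (Fin 3)).erase 0 = {1, 2} by decide,
    show (Finset.univ : Finset (Fin 3)).erase 1 = {0, 2} by decide,
    show (Finset.univ : Finset (Fin 3)).erase 2 = {0, 1} by decide]
  ring

/-- This removes the branch: `phiHat` enters `gaugeDeriv` only through its logarithmic derivative,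
which is single-valued and independent of the base point. -/
theorem derivWp_iterate_phiHat (hx : x ∈ regularSet P) (hf : AnalyticAt ℂ f x) (k : ℕ) :
    (derivWp P)^[k] (fun y => (phiHat P α x y)⁻¹ * f y) =ᶠ[𝓝 x]
      fun y => (phiHat P α x y)⁻¹ * (gaugeDeriv P α)^[k] f y := by
  induction k with
  | zero => simp
  | succ k ih =>
    rw [Function.iterate_succ_apply', Function.iterate_succ_apply']
    refine (derivWp_congr ih).trans ?_
    filter_upwards [eventually_hasDerivAt_phiHat (α := α) hx, eventually_mem_regularSet hx,
      (analyticAt_gaugeDeriv_iterate (α := α) hx hf k).eventually_analyticAt] with y hy hyU hfy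
    have h1 := (hy.inv (phiHat_ne hx hyU)).mul hfy.differentiableAt.hasDerivAt
    have h2 : deriv (fun y => (phiHat P α x y)⁻¹ * (gaugeDeriv P α)^[k] f y) y = _ := h1.deriv
    have h3 := phiHat_ne (α := α) hx hyU
    have h4 := derivWeierstrassP_ne hyU
    rw [derivWp, h2, gaugeDeriv]
    simp only [Pi.inv_apply]
    field_simp
    ring

/-- The operator `℘' ^ n ∇ ^ n`, where `∇` is `gaugeDeriv`. -/
def gaugePow (P : PeriodPair) (α : Fin 4 → ℤ) (n : ℕ) (f : ℂ → ℂ) (x : ℂ) : ℂ :=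
  P.derivWeierstrassP x ^ n * (gaugeDeriv P α)^[n] f x

theorem darboux_eq_gaugePow (hx : x ∈ regularSet P) (hf : AnalyticAt ℂ f x) :
    darboux P α f x = gaugePow P α ((-(∑ i, α i) / 2).toNat + 1) f x := by
  have h := (derivWp_iterate_phiHat (α := α) hx hf ((-(∑ i, α i) / 2).toNat + 1)).eq_of_nhds
  simp only [darboux, gaugePow, h]
  have := phiHat_ne (α := α) hx hx
  field_simp

end

/-! ### The Leibniz rule for ∇ with polynomial coefficients in ℘ -/

section

variable {P : PeriodPair} {α : Fin 4 → ℤ} {x : ℂ} {f g : ℂ → ℂ}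

theorem gaugeDeriv_add (hf : AnalyticAt ℂ f x) (hg : AnalyticAt ℂ g x) :
    gaugeDeriv P α (fun y => f y + g y) x = gaugeDeriv P α f x + gaugeDeriv P α g x := by
  simp only [gaugeDeriv, deriv_fun_add hf.differentiableAt hg.differentiableAt]
  ring

theorem hasDerivAt_eval_weierstrassP (hx : x ∈ regularSet P) (A : Polynomial ℂ) :
    HasDerivAt (fun y => A.eval (P.weierstrassP y))
      (A.derivative.eval (P.weierstrassP x) * P.derivWeierstrassP x) x :=
  (A.hasDerivAt (P.weierstrassP x)).comp x (hasDerivAt_weierstrassP hx)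

theorem analyticAt_eval_weierstrassP (hx : x ∈ regularSet P) (A : Polynomial ℂ) :
    AnalyticAt ℂ (fun y => A.eval (P.weierstrassP y)) x := by
  have := (analyticAt_weierstrassP hx).aeval_polynomial A
  simpa [Polynomial.coe_aeval_eq_eval] using this

theorem gaugeDeriv_eval_mul (hx : x ∈ regularSet P) (hf : AnalyticAt ℂ f x) (A : Polynomial ℂ) :
    gaugeDeriv P α (fun y => A.eval (P.weierstrassP y) * f y) x =
      A.derivative.eval (P.weierstrassP x) * f x +
        A.eval (P.weierstrassP x) * gaugeDeriv P α f x := by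
  have hA := hasDerivAt_eval_weierstrassP hx A
  have h : deriv (fun y => A.eval (P.weierstrassP y) * f y) x = _ :=
    (hA.mul hf.differentiableAt.hasDerivAt).deriv
  have h4 := derivWeierstrassP_ne hx
  simp only [gaugeDeriv, h]
  field_simp
  ring

theorem gaugeDeriv_four (hx : x ∈ regularSet P) (A₀ A₁ A₂ A₃ : Polynomial ℂ)
    {f₀ f₁ f₂ f₃ : ℂ → ℂ} (h₀ : AnalyticAt ℂ f₀ x) (h₁ : AnalyticAt ℂ f₁ x)
    (h₂ : AnalyticAt ℂ f₂ x) (h₃ : AnalyticAt ℂ f₃ x) :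
    gaugeDeriv P α (fun y => A₀.eval (P.weierstrassP y) * f₀ y +
      (A₁.eval (P.weierstrassP y) * f₁ y + (A₂.eval (P.weierstrassP y) * f₂ y +
        A₃.eval (P.weierstrassP y) * f₃ y))) x =
      (A₀.derivative.eval (P.weierstrassP x) * f₀ x +
        A₀.eval (P.weierstrassP x) * gaugeDeriv P α f₀ x) +
      ((A₁.derivative.eval (P.weierstrassP x) * f₁ x +
        A₁.eval (P.weierstrassP x) * gaugeDeriv P α f₁ x) +
      ((A₂.derivative.eval (P.weierstrassP x) * f₂ x +
        A₂.eval (P.weierstrassP x) * gaugeDeriv P α f₂ x) +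
      (A₃.derivative.eval (P.weierstrassP x) * f₃ x +
        A₃.eval (P.weierstrassP x) * gaugeDeriv P α f₃ x))) := by
  have a₀ := (analyticAt_eval_weierstrassP hx A₀).fun_mul h₀
  have a₁ := (analyticAt_eval_weierstrassP hx A₁).fun_mul h₁
  have a₂ := (analyticAt_eval_weierstrassP hx A₂).fun_mul h₂
  have a₃ := (analyticAt_eval_weierstrassP hx A₃).fun_mul h₃
  rw [gaugeDeriv_add a₀ (a₁.fun_add (a₂.fun_add a₃)), gaugeDeriv_add a₁ (a₂.fun_add a₃),
    gaugeDeriv_add a₂ a₃, gaugeDeriv_eval_mul hx h₀, gaugeDeriv_eval_mul hx h₁,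
    gaugeDeriv_eval_mul hx h₂, gaugeDeriv_eval_mul hx h₃]

open Polynomial in
/-- The Leibniz rule for `∇ ^ (m + 1) (A ∇² + B ∇ + C)`, where `A`, `B`, `C` are polynomials in
`℘` of degree at most `3`, `2`, `1`. -/
theorem gaugeDeriv_iterate_quadratic (hx : x ∈ regularSet P) (hf : AnalyticAt ℂ f x)
    (A B C' : ℂ[X]) (hA : derivative^[4] A = 0) (hB : derivative^[3] B = 0)
    (hC : derivative^[2] C' = 0) (m : ℕ) :
    (gaugeDeriv P α)^[m + 1] (fun y => A.eval (P.weierstrassP y) * (gaugeDeriv P α)^[2] f y +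
      (B.eval (P.weierstrassP y) * (gaugeDeriv P α)^[1] f y +
        C'.eval (P.weierstrassP y) * f y)) =ᶠ[𝓝 x]
    fun y => A.eval (P.weierstrassP y) * (gaugeDeriv P α)^[m + 3] f y +
      (((m + 1) • derivative A + B).eval (P.weierstrassP y) * (gaugeDeriv P α)^[m + 2] f y +
      ((C (((m + 1) * m / 2 : ℂ)) * derivative^[2] A + (m + 1) • derivative B + C').eval
        (P.weierstrassP y) * (gaugeDeriv P α)^[m + 1] f y +
      (C (((m + 1) * m * (m - 1) / 6 : ℂ)) * derivative^[3] A +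
        C (((m + 1) * m / 2 : ℂ)) * derivative^[2] B + (m + 1) • derivative C').eval
        (P.weierstrassP y) * (gaugeDeriv P α)^[m] f y)) := by
  have han (k : ℕ) : ∀ᶠ y in 𝓝 x, AnalyticAt ℂ ((gaugeDeriv P α)^[k] f) y :=
    (analyticAt_gaugeDeriv_iterate hx hf k).eventually_analyticAt
  have hs (k : ℕ) (y : ℂ) : gaugeDeriv P α ((gaugeDeriv P α)^[k] f) y =
      (gaugeDeriv P α)^[k + 1] f y := by rw [Function.iterate_succ_apply']
  simp only [Function.iterate_succ, Function.iterate_zero, Function.comp, id] at hA hB hC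
  induction m with
  | zero =>
    filter_upwards [eventually_mem_regularSet hx, han 0, han 1, han 2] with y hy h0 h1 h2
    -- Before differentiation there are only three terms; the fourth is padded with 0.
    have := gaugeDeriv_four (α := α) hy A B C' 0 h2 h1 h0 h0
    simp only [eval_zero, zero_mul, add_zero, derivative_zero, hs, Function.iterate_zero, id]
      at this
    simp only [zero_add, Function.iterate_one]
    simp only [Function.iterate_one] at this
    rw [this]
    simp
    ring
  | succ m ih =>
    rw [Function.iterate_succ_apply']
    refine (gaugeDeriv_congr ih).trans ?_
    filter_upwards [eventually_mem_regularSet hx, han m, han (m + 1), han (m + 2), han (m + 3)]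
      with y hy h0 h1 h2 h3
    rw [gaugeDeriv_four hy _ _ _ _ h3 h2 h1 h0]
    simp only [hs]
    -- The degree bounds stop a fifth term from appearing. The rest is Pascal's rule for the
    -- binomial coefficients of m + 1.
    simp [hA, hB, hC]
    ring

end

/-! ### The Hamiltonian as a Heun operator -/

section

section polynomials

open Polynomial

/-- The polynomial `4 ∏ (z - e_i)`, which at `z = ℘` is `℘' ^ 2`. -/
def heunA (P : PeriodPair) : ℂ[X] :=
  C 4 * ((X - C (eVal P 1)) * ((X - C (eVal P 2)) * (X - C (eVal P 3))))

/-- The coefficient of the first derivative in the gauged Hamiltonian. -/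
def heunB (P : PeriodPair) (α : Fin 4 → ℤ) : ℂ[X] :=
  C (4 * ((α 1 : ℂ) + 1 / 2)) * ((X - C (eVal P 2)) * (X - C (eVal P 3))) +
    C (4 * ((α 2 : ℂ) + 1 / 2)) * ((X - C (eVal P 1)) * (X - C (eVal P 3))) +
    C (4 * ((α 3 : ℂ) + 1 / 2)) * ((X - C (eVal P 1)) * (X - C (eVal P 2)))

/-- The coefficient of order zero in the gauged Hamiltonian. -/
def heunC (P : PeriodPair) (α : Fin 4 → ℤ) : ℂ[X] :=
  C ((α 1 : ℂ) * (α 1 - 1)) * (X + C (eVal P 1)) +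
    C ((α 2 : ℂ) * (α 2 - 1)) * (X + C (eVal P 2)) +
    C ((α 3 : ℂ) * (α 3 - 1)) * (X + C (eVal P 3)) -
    C ((α 0 : ℂ) * (α 0 - 1)) * X +
    C (2 * (α 1 : ℂ) * α 2 + (α 1 + α 2)) * (X - C (eVal P 3)) +
    C (2 * (α 1 : ℂ) * α 3 + (α 1 + α 3)) * (X - C (eVal P 2)) +
    C (2 * (α 2 : ℂ) * α 3 + (α 2 + α 3)) * (X - C (eVal P 1))

variable (P : PeriodPair) (α : Fin 4 → ℤ)

theorem derivative_heunA : derivative (heunA P) =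
    C 4 * ((X - C (eVal P 2)) * (X - C (eVal P 3)) + (X - C (eVal P 1)) * (X - C (eVal P 3)) +
      (X - C (eVal P 1)) * (X - C (eVal P 2))) := by
  simp [heunA]
  ring

theorem derivative_two_heunA : derivative^[2] (heunA P) = C 24 * X := by
  have h : (C (eVal P 1) + C (eVal P 2) + C (eVal P 3) : ℂ[X]) = 0 := by
    rw [← C_add, ← C_add, eVal_sum, C_0]
  simp only [Function.iterate_succ, Function.iterate_zero, Function.comp, id, derivative_heunA]
  simp
  rw [show (C 24 : ℂ[X]) = 24 from rfl, show (C 4 : ℂ[X]) = 4 from rfl]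
  linear_combination (-8 : ℂ[X]) * h

theorem derivative_three_heunA : derivative^[3] (heunA P) = C 24 := by
  rw [Function.iterate_succ_apply', derivative_two_heunA]
  simp

theorem derivative_four_heunA : derivative^[4] (heunA P) = 0 := by
  rw [Function.iterate_succ_apply', derivative_three_heunA]
  simp

theorem derivative_two_heunB :
    derivative^[2] (heunB P α) = C (8 * ((α 1 : ℂ) + α 2 + α 3) + 12) := by
  simp only [Function.iterate_succ, Function.iterate_zero, Function.comp, id, heunB]
  simp only [derivative_add, derivative_mul, derivative_sub, derivative_X, derivative_C,
    derivative_one, derivative_zero, C_add, C_mul]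
  rw [show (C (1 / 2) : ℂ[X]) = C 2⁻¹ by norm_num]
  have h2 : (C 2⁻¹ : ℂ[X]) * 2 = 1 := by
    rw [show (2 : ℂ[X]) = C 2 from rfl, ← C_mul]
    norm_num
  rw [show (C 8 : ℂ[X]) = 8 from rfl, show (C 12 : ℂ[X]) = 12 from rfl,
    show (C 4 : ℂ[X]) = 4 from rfl]
  linear_combination (12 : ℂ[X]) * h2

theorem derivative_three_heunB : derivative^[3] (heunB P α) = 0 := by
  rw [Function.iterate_succ_apply', derivative_two_heunB]
  simp

theorem derivative_heunC : derivative (heunC P α) =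
    C ((α 1 : ℂ) * (α 1 - 1) + (α 2 : ℂ) * (α 2 - 1) + (α 3 : ℂ) * (α 3 - 1) -
      (α 0 : ℂ) * (α 0 - 1) + 2 * (α 1 * α 2 + α 1 * α 3 + α 2 * α 3 + α 1 + α 2 + α 3)) := by
  simp only [heunC, derivative_add, derivative_mul, derivative_sub, derivative_X, derivative_C,
    zero_mul, add_zero, zero_add, sub_zero, mul_one, ← C_add, ← C_sub]
  congr 1
  ring

theorem derivative_two_heunC : derivative^[2] (heunC P α) = 0 := by
  rw [Function.iterate_succ_apply', Function.iterate_one, derivative_heunC]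
  simp

end polynomials

variable {P : PeriodPair} {α : Fin 4 → ℤ} {x : ℂ} {f g : ℂ → ℂ}

theorem gaugeLog_eq : gaugeLog P α x = (α 1 : ℂ) / 2 / (P.weierstrassP x - eVal P 1) +
    (α 2 : ℂ) / 2 / (P.weierstrassP x - eVal P 2) +
    (α 3 : ℂ) / 2 / (P.weierstrassP x - eVal P 3) := by
  simp [gaugeLog, Fin.sum_univ_three]

theorem hasDerivAt_gaugeLog (hx : x ∈ regularSet P) : HasDerivAt (gaugeLog P α)
    (-P.derivWeierstrassP x * ((α 1 : ℂ) / 2 / (P.weierstrassP x - eVal P 1) ^ 2 +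
    (α 2 : ℂ) / 2 / (P.weierstrassP x - eVal P 2) ^ 2 +
    (α 3 : ℂ) / 2 / (P.weierstrassP x - eVal P 3) ^ 2)) x := by
  have h := hasDerivAt_weierstrassP hx
  have h1 := ((h.sub_const (eVal P 1)).fun_inv (weierstrassP_sub_one_ne hx)).const_mul
    ((α 1 : ℂ) / 2)
  have h2 := ((h.sub_const (eVal P 2)).fun_inv (weierstrassP_sub_two_ne hx)).const_mul
    ((α 2 : ℂ) / 2)
  have h3 := ((h.sub_const (eVal P 3)).fun_inv (weierstrassP_sub_three_ne hx)).const_mul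
    ((α 3 : ℂ) / 2)
  refine (((h1.fun_add h2).fun_add h3).congr_of_eventuallyEq
    (Eventually.of_forall fun y => gaugeLog_eq)).congr_deriv ?_
  ring

theorem deriv_deriv_eq_gaugeDeriv (hx : x ∈ regularSet P) (hf : AnalyticAt ℂ f x) :
    deriv (deriv f) x =
      P.derivWeierstrassP x ^ 2 * (gaugeDeriv P α)^[2] f x +
      (2 * P.derivWeierstrassP x ^ 2 * gaugeLog P α x + deriv P.derivWeierstrassP x) *
        gaugeDeriv P α f x +
      (deriv P.derivWeierstrassP x * gaugeLog P α x +
        P.derivWeierstrassP x * deriv (gaugeLog P α) x +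
        P.derivWeierstrassP x ^ 2 * gaugeLog P α x ^ 2) * f x := by
  have h1 : deriv f =ᶠ[𝓝 x] fun y =>
      P.derivWeierstrassP y * (gaugeDeriv P α f y + gaugeLog P α y * f y) :=
    (eventually_mem_regularSet hx).mono fun y hy => deriv_eq_gaugeDeriv hy f
  have hq := (analyticAt_derivWeierstrassP hx).differentiableAt.hasDerivAt
  have hs := (analyticAt_gaugeLog (α := α) hx).differentiableAt.hasDerivAt
  have hf' := hf.differentiableAt.hasDerivAt
  have hg := (analyticAt_gaugeDeriv (α := α) hx hf).differentiableAt.hasDerivAt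
  rw [h1.deriv_eq, (hq.fun_mul (hg.fun_add (hs.fun_mul hf'))).deriv,
    deriv_eq_gaugeDeriv (α := α) hx (gaugeDeriv P α f), deriv_eq_gaugeDeriv (α := α) hx f]
  simp only [Function.iterate_succ, Function.iterate_zero, Function.comp, id]
  ring

/-- The Hamiltonian in the gauge `∏ (℘ - e_i) ^ (α_i / 2)`. -/
theorem hamiltonian_eq_heun (hx : x ∈ regularSet P) (hf : AnalyticAt ℂ f x) (l : Fin 4 → ℤ)
    (hl : ∀ i, l i * (l i + 1) = α i * (α i - 1)) :
    hamiltonian P l f x = -((heunA P).eval (P.weierstrassP x) * (gaugeDeriv P α)^[2] f x +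
      ((heunB P α).eval (P.weierstrassP x) * (gaugeDeriv P α)^[1] f x +
        (heunC P α).eval (P.weierstrassP x) * f x)) := by
  have hl' (i : Fin 4) : (l i : ℂ) * ((l i : ℂ) + 1) = α i * (α i - 1) := by exact_mod_cast hl i
  have u1 := weierstrassP_sub_one_ne hx
  have u2 := weierstrassP_sub_two_ne hx
  have u3 := weierstrassP_sub_three_ne hx
  have h3 : eVal P 3 = -eVal P 1 - eVal P 2 := by linear_combination eVal_sum P
  have hq := derivWeierstrassP_sq_eq_prod P (notMem_lattice_of_mem_regularSet P hx)
  simp only [hamiltonian, Fin.sum_univ_four, hl', weierstrassP_add_one hx,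
    weierstrassP_add_two hx, weierstrassP_add_three hx, Function.iterate_one]
  rw [show P.weierstrassP (x + halfPeriod P 0) = P.weierstrassP x by simp [halfPeriod],
    deriv_deriv_eq_gaugeDeriv (α := α) hx hf]
  have cA : (heunA P).eval (P.weierstrassP x) = P.derivWeierstrassP x ^ 2 := by
    rw [hq]
    simp [heunA]
    ring
  have cB : (heunB P α).eval (P.weierstrassP x) =
      2 * P.derivWeierstrassP x ^ 2 * gaugeLog P α x + deriv P.derivWeierstrassP x := by
    rw [hq, deriv_derivWeierstrassP hx, gaugeLog_eq]
    simp [heunB]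
    field_simp
    ring
  have cC : (heunC P α).eval (P.weierstrassP x) =
      (deriv P.derivWeierstrassP x * gaugeLog P α x +
        P.derivWeierstrassP x * deriv (gaugeLog P α) x +
        P.derivWeierstrassP x ^ 2 * gaugeLog P α x ^ 2) -
      ((α 0 : ℂ) * (α 0 - 1) * P.weierstrassP x +
        α 1 * (α 1 - 1) * (eVal P 1 + (eVal P 3 - eVal P 1) * (eVal P 2 - eVal P 1) /
          (P.weierstrassP x - eVal P 1)) +
        α 2 * (α 2 - 1) * (eVal P 2 + (eVal P 1 - eVal P 2) * (eVal P 3 - eVal P 2) /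
          (P.weierstrassP x - eVal P 2)) +
        α 3 * (α 3 - 1) * (eVal P 3 + (eVal P 2 - eVal P 3) * (eVal P 1 - eVal P 3) /
          (P.weierstrassP x - eVal P 3))) := by
    -- The derivative of `gaugeLog` carries a factor ℘', so ℘' occurs only squared and can be
    -- eliminated in favour of ℘.
    rw [(hasDerivAt_gaugeLog hx).deriv, show ∀ a b c d e : ℂ, a * b + c * (-c * d) + c ^ 2 * e =
      a * b + c ^ 2 * (e - d) by intros; ring, hq, deriv_derivWeierstrassP hx, gaugeLog_eq]
    simp [heunC]
    rw [h3] at u3 ⊢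
    field_simp
    ring
  rw [cA, cB, cC]
  ring

/-- From ℘'² = 4 ∏ (℘ - e_i), ℘'^n is a constant times ∏ (℘ - e_i)^(n/2), so multiplying by it
raises every gauge exponent α_i by n. -/
theorem gaugeDeriv_pow_mul (hx : x ∈ regularSet P) (hf : AnalyticAt ℂ f x) (n : ℕ) :
    gaugeDeriv P (fun i => α i + n) (fun y => P.derivWeierstrassP y ^ n * f y) x =
      P.derivWeierstrassP x ^ n * gaugeDeriv P α f x := by
  have hq := (analyticAt_derivWeierstrassP hx).differentiableAt.hasDerivAt
  have h0 := derivWeierstrassP_ne hx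
  have u1 := weierstrassP_sub_one_ne hx
  have u2 := weierstrassP_sub_two_ne hx
  have u3 := weierstrassP_sub_three_ne hx
  have hs : gaugeLog P (fun i => α i + n) x = gaugeLog P α x +
      n * deriv P.derivWeierstrassP x / P.derivWeierstrassP x ^ 2 := by
    rw [derivWeierstrassP_sq_eq_prod P (notMem_lattice_of_mem_regularSet P hx),
      deriv_derivWeierstrassP hx, gaugeLog_eq, gaugeLog_eq]
    push_cast
    field_simp
    ring
  -- The factor `n` makes the truncated exponent `n - 1` harmless at `n = 0`.
  have hn : (n : ℂ) * P.derivWeierstrassP x ^ (n - 1) =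
      n * P.derivWeierstrassP x ^ n / P.derivWeierstrassP x := by
    cases n with
    | zero => simp
    | succ n => simp [pow_succ]; field_simp
  rw [gaugeDeriv, ((hq.fun_pow n).fun_mul hf.differentiableAt.hasDerivAt).deriv, hs, hn, gaugeDeriv]
  field_simp
  ring

end

/-! ### The intertwining relation for L_α -/

section

variable {P : PeriodPair} {α : Fin 4 → ℤ} {x : ℂ} {f g : ℂ → ℂ}

theorem gaugeDeriv_iterate_congr (h : f =ᶠ[𝓝 x] g) (n : ℕ) :
    (gaugeDeriv P α)^[n] f =ᶠ[𝓝 x] (gaugeDeriv P α)^[n] g := by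
  induction n with
  | zero => simpa
  | succ n ih =>
    rw [Function.iterate_succ_apply', Function.iterate_succ_apply']
    exact gaugeDeriv_congr ih

theorem gaugeDeriv_neg : gaugeDeriv P α (fun y => -f y) = fun y => -gaugeDeriv P α f y := by
  funext y
  simp [gaugeDeriv]
  ring

theorem gaugeDeriv_iterate_neg (n : ℕ) :
    (gaugeDeriv P α)^[n] (fun y => -f y) = fun y => -(gaugeDeriv P α)^[n] f y := by
  induction n with
  | zero => simp
  | succ n ih => rw [Function.iterate_succ_apply', ih, gaugeDeriv_neg, Function.iterate_succ_apply']

section coefficients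

variable (P)

open Polynomial

theorem heunB_shift (n : ℕ) :
    n • derivative (heunA P) + heunB P α = heunB P fun i => α i + n := by
  rw [derivative_heunA, heunB, heunB]
  have h4 : (C (4 : ℂ)) = 4 := rfl
  simp only [nsmul_eq_mul, Int.cast_add, Int.cast_natCast, C_mul, C_add, h4, ← C_eq_natCast]
  ring

theorem derivative_heunB : derivative (heunB P α) =
    C (8 * ((α 1 : ℂ) + α 2 + α 3) + 12) * X -
      C (4 * (α 1 * (eVal P 2 + eVal P 3) + α 2 * (eVal P 1 + eVal P 3) +
        α 3 * (eVal P 1 + eVal P 2))) := by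
  have h3 : eVal P 3 = -eVal P 1 - eVal P 2 := by linear_combination eVal_sum P
  apply Polynomial.funext
  intro z
  simp [heunB, h3]
  ring

/-- Unlike `heunB`, `heunC` involves α_0, so the shift of all four exponents needs the condition on
their sum. -/
theorem heunC_shift (m : ℕ) (hm : ∑ i, α i = -2 * m) :
    C (((m + 1) * m / 2 : ℂ)) * derivative^[2] (heunA P) + (m + 1) • derivative (heunB P α) +
      heunC P α = heunC P fun i => α i + (m + 1 : ℕ) := by
  have h3 : eVal P 3 = -eVal P 1 - eVal P 2 := by linear_combination eVal_sum P
  have h0 : (α 0 : ℂ) = -2 * m - α 1 - α 2 - α 3 := by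
    rw [Fin.sum_univ_four] at hm
    have : (α 0 + α 1 + α 2 + α 3 : ℂ) = -2 * m := by exact_mod_cast hm
    linear_combination this
  rw [derivative_two_heunA, derivative_heunB]
  apply Polynomial.funext
  intro z
  simp [heunC, h3, h0]
  ring

/-- The left side is the constant (m + 1)(∑ α_i + 2m)(α_1 + α_2 + α_3 - α_0 + 2m + 1). It is the
coefficient of ∇^m in the Leibniz expansion. -/
theorem heun_quasi_solvable (m : ℕ) (hm : ∑ i, α i = -2 * m) :
    C (((m + 1) * m * (m - 1) / 6 : ℂ)) * derivative^[3] (heunA P) +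
        C (((m + 1) * m / 2 : ℂ)) * derivative^[2] (heunB P α) +
        (m + 1) • derivative (heunC P α) = 0 := by
  have h0 : (α 0 : ℂ) = -2 * m - α 1 - α 2 - α 3 := by
    rw [Fin.sum_univ_four] at hm
    have : (α 0 + α 1 + α 2 + α 3 : ℂ) = -2 * m := by exact_mod_cast hm
    linear_combination this
  rw [derivative_three_heunA, derivative_two_heunB, derivative_heunC]
  apply Polynomial.funext
  intro z
  simp [h0]
  ring

end coefficients

theorem gaugePow_hamiltonian (hx : x ∈ regularSet P) (hf : AnalyticAt ℂ f x) (m : ℕ)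
    (hm : ∑ i, α i = -2 * m) (l l' : Fin 4 → ℤ) (hl : ∀ i, l i * (l i + 1) = α i * (α i - 1))
    (hl' : ∀ i, l' i * (l' i + 1) = (α i + m) * (α i + m + 1)) :
    gaugePow P α (m + 1) (hamiltonian P l f) x = hamiltonian P l' (gaugePow P α (m + 1) f) x := by
  have hH : hamiltonian P l f =ᶠ[𝓝 x] fun y =>
      -((heunA P).eval (P.weierstrassP y) * (gaugeDeriv P α)^[2] f y +
      ((heunB P α).eval (P.weierstrassP y) * (gaugeDeriv P α)^[1] f y +
        (heunC P α).eval (P.weierstrassP y) * f y)) := by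
    filter_upwards [eventually_mem_regularSet hx, hf.eventually_analyticAt] with y hy hfy
    exact hamiltonian_eq_heun hy hfy l hl
  have han (k : ℕ) : AnalyticAt ℂ ((gaugeDeriv P α)^[k] f) x :=
    analyticAt_gaugeDeriv_iterate hx hf k
  have hg : AnalyticAt ℂ (gaugePow P α (m + 1) f) x :=
    ((analyticAt_derivWeierstrassP hx).pow (m + 1)).mul (han (m + 1))
  have hpow : gaugeDeriv P (fun i => α i + (m + 1 : ℕ)) (gaugePow P α (m + 1) f) =ᶠ[𝓝 x]
      fun y => P.derivWeierstrassP y ^ (m + 1) * (gaugeDeriv P α)^[m + 2] f y := by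
    filter_upwards [eventually_mem_regularSet hx, (han (m + 1)).eventually_analyticAt] with y hy hfy
    rw [Function.iterate_succ_apply']
    exact gaugeDeriv_pow_mul hy hfy (m + 1)
  have hpow2 : gaugeDeriv P (fun i => α i + (m + 1 : ℕ))
      (gaugeDeriv P (fun i => α i + (m + 1 : ℕ)) (gaugePow P α (m + 1) f)) x =
      P.derivWeierstrassP x ^ (m + 1) * (gaugeDeriv P α)^[m + 3] f x := by
    rw [(gaugeDeriv_congr hpow).eq_of_nhds, gaugeDeriv_pow_mul hx (han (m + 2)) (m + 1),
      ← Function.iterate_succ_apply' (gaugeDeriv P α)]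
  rw [hamiltonian_eq_heun hx hg (α := fun i => α i + (m + 1 : ℕ)) l' (by
    intro i
    rw [hl']
    push_cast
    ring), gaugePow, (gaugeDeriv_iterate_congr hH (m + 1)).eq_of_nhds, gaugeDeriv_iterate_neg]
  beta_reduce
  -- The ∇^m term drops out and the other coefficients become those of the Heun operator for α + m +
  -- 1.
  rw [(gaugeDeriv_iterate_quadratic hx hf _ _ _ (derivative_four_heunA P)
      (derivative_three_heunB P α) (derivative_two_heunC P α) m).eq_of_nhds,
    heun_quasi_solvable P m hm, heunC_shift P m hm, heunB_shift P]
  simp only [Function.iterate_succ (f := gaugeDeriv P fun i => α i + (m + 1 : ℕ)),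
    Function.iterate_zero, Function.comp, id]
  rw [hpow2, hpow.eq_of_nhds]
  simp only [gaugePow, Polynomial.eval_zero, zero_mul, add_zero]
  ring

end

/-! ### Calculus of monic differential operators -/

section

/-- The admissible coefficients: meromorphic functions that are holomorphic on `U`. -/
def IsCoeffOn (U : Set ℂ) (c : ℂ → ℂ) : Prop := AnalyticOnNhd ℂ c U ∧ Meromorphic c

/-- `T` is a differential operator of order less than `n` on `U`. -/
def IsDiffOpLTOn (U : Set ℂ) (n : ℕ) (T : (ℂ → ℂ) → (ℂ → ℂ)) : Prop :=
  ∃ c : ℕ → ℂ → ℂ, (∀ i, IsCoeffOn U (c i)) ∧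
    OpEqOn U T (fun f x => ∑ i ∈ Finset.range n, c i x * iteratedDeriv i f x)

section

variable {U : Set ℂ} {m n : ℕ} {S T : (ℂ → ℂ) → (ℂ → ℂ)} {c d f g : ℂ → ℂ} {x : ℂ}

theorem isCoeffOn_const (U : Set ℂ) (a : ℂ) : IsCoeffOn U fun _ => a :=
  ⟨fun _ _ => analyticAt_const, Meromorphic.const a⟩

theorem IsCoeffOn.add (hc : IsCoeffOn U c) (hd : IsCoeffOn U d) : IsCoeffOn U (fun x => c x + d x) :=
  ⟨hc.1.add hd.1, hc.2.add hd.2⟩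

theorem IsCoeffOn.mul (hc : IsCoeffOn U c) (hd : IsCoeffOn U d) : IsCoeffOn U (fun x => c x * d x) :=
  ⟨hc.1.mul hd.1, hc.2.mul hd.2⟩

theorem IsCoeffOn.deriv (hc : IsCoeffOn U c) : IsCoeffOn U (deriv c) :=
  ⟨hc.1.deriv, hc.2.deriv⟩

theorem IsCoeffOn.inv (hc : IsCoeffOn U c) (h : ∀ x ∈ U, c x ≠ 0) :
    IsCoeffOn U (fun x => (c x)⁻¹) :=
  ⟨hc.1.inv h, hc.2.inv⟩

theorem OpEqOn.trans {R : (ℂ → ℂ) → (ℂ → ℂ)} (h : OpEqOn U S T) (h' : OpEqOn U T R) :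
    OpEqOn U S R := fun x hx f hf => (h x hx f hf).trans (h' x hx f hf)

theorem OpEqOn.eventuallyEq (h : OpEqOn U S T) (hU : IsOpen U) (hx : x ∈ U)
    (hf : AnalyticAt ℂ f x) : S f =ᶠ[𝓝 x] T f := by
  filter_upwards [hU.mem_nhds hx, hf.eventually_analyticAt] with y hy hfy
  exact h y hy f hfy

theorem OpEqOn.isDiffOpLTOn (h : OpEqOn U S T) (hT : IsDiffOpLTOn U n T) : IsDiffOpLTOn U n S := by
  obtain ⟨c, hc, hT⟩ := hT
  exact ⟨c, hc, h.trans hT⟩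

/-- Splitting off the leading term lets composition be handled without formulas for the lower
coefficients. -/
theorem isMonicDiffOpOn_iff : IsMonicDiffOpOn U n T ↔ ∃ S, IsDiffOpLTOn U n S ∧
    OpEqOn U T (fun f x => iteratedDeriv n f x + S f x) := by
  constructor
  · rintro ⟨c, hc, h⟩
    refine ⟨fun f x => ∑ i : Fin n, c i x * iteratedDeriv i f x,
      ⟨fun i => if h : i < n then c ⟨i, h⟩ else fun _ => 0, fun i => ?_, fun x _ f _ => ?_⟩, h⟩
    · beta_reduce
      split_ifs with hi
      · exact hc _
      · exact isCoeffOn_const U 0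
    · simp [Finset.sum_range]
  · rintro ⟨S, ⟨c, hc, hS⟩, h⟩
    refine ⟨fun i => c i, fun i => hc i, fun x hx f hf => ?_⟩
    rw [h x hx f hf]
    beta_reduce
    rw [hS x hx f hf]
    simp [Finset.sum_range]

theorem analyticAt_iteratedDeriv (hf : AnalyticAt ℂ f x) (i : ℕ) :
    AnalyticAt ℂ (iteratedDeriv i f) x := by
  induction i with
  | zero => simpa
  | succ i ih =>
    rw [iteratedDeriv_succ]
    exact ih.deriv

theorem IsDiffOpLTOn.analyticAt (hT : IsDiffOpLTOn U n T) (hU : IsOpen U) (hx : x ∈ U)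
    (hf : AnalyticAt ℂ f x) : AnalyticAt ℂ (T f) x := by
  obtain ⟨c, hc, hT⟩ := hT
  refine AnalyticAt.congr ?_ (hT.eventuallyEq hU hx hf).symm
  exact Finset.analyticAt_fun_sum _ fun i _ => ((hc i).1 x hx).mul (analyticAt_iteratedDeriv hf i)

theorem isDiffOpLTOn_zero : IsDiffOpLTOn U n fun _ _ => 0 :=
  ⟨fun _ _ => 0, fun _ => isCoeffOn_const U 0, fun _ _ _ _ => by simp⟩

theorem isDiffOpLTOn_mul_iteratedDeriv (hc : IsCoeffOn U c) {i : ℕ} (hi : i < n) :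
    IsDiffOpLTOn U n fun f x => c x * iteratedDeriv i f x := by
  refine ⟨fun j => if j = i then c else fun _ => 0, fun j => ?_, fun x _ f _ => ?_⟩
  · beta_reduce
    split_ifs
    · exact hc
    · exact isCoeffOn_const U 0
  · beta_reduce
    rw [Finset.sum_eq_single i]
    · simp
    · intro j _ hj
      simp [hj]
    · simp [hi]

theorem IsDiffOpLTOn.add (hS : IsDiffOpLTOn U n S) (hT : IsDiffOpLTOn U n T) :
    IsDiffOpLTOn U n fun f x => S f x + T f x := by
  obtain ⟨c, hc, hS⟩ := hS
  obtain ⟨d, hd, hT⟩ := hT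
  refine ⟨fun i x => c i x + d i x, fun i => (hc i).add (hd i), fun x hx f hf => ?_⟩
  simp only [hS x hx f hf, hT x hx f hf, add_mul, Finset.sum_add_distrib]

theorem IsDiffOpLTOn.coeff_mul (hT : IsDiffOpLTOn U n T) (hc : IsCoeffOn U c) :
    IsDiffOpLTOn U n fun f x => c x * T f x := by
  obtain ⟨d, hd, hT⟩ := hT
  refine ⟨fun i x => c x * d i x, fun i => hc.mul (hd i), fun x hx f hf => ?_⟩
  simp only [hT x hx f hf, Finset.mul_sum, mul_assoc]

theorem isDiffOpLTOn_sum {ι : Type*} (s : Finset ι) (T : ι → (ℂ → ℂ) → (ℂ → ℂ))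
    (h : ∀ i ∈ s, IsDiffOpLTOn U n (T i)) : IsDiffOpLTOn U n fun f x => ∑ i ∈ s, T i f x := by
  classical
  induction s using Finset.induction_on with
  | empty => simpa using isDiffOpLTOn_zero
  | insert a s ha ih =>
    simp only [Finset.sum_insert ha]
    exact (h a (by simp)).add (ih fun i hi => h i (by simp [hi]))

theorem IsDiffOpLTOn.mono (hT : IsDiffOpLTOn U m T) (hmn : m ≤ n) : IsDiffOpLTOn U n T := by
  obtain ⟨c, hc, hT⟩ := hT
  refine OpEqOn.isDiffOpLTOn hT (isDiffOpLTOn_sum _ (fun i f x => c i x * iteratedDeriv i f x)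
    fun i hi => isDiffOpLTOn_mul_iteratedDeriv (hc i) ?_)
  exact (Finset.mem_range.mp hi).trans_le hmn

theorem IsDiffOpLTOn.deriv_comp (hT : IsDiffOpLTOn U n T) (hU : IsOpen U) :
    IsDiffOpLTOn U (n + 1) fun f => deriv (T f) := by
  obtain ⟨c, hc, hT⟩ := hT
  refine OpEqOn.isDiffOpLTOn (T := fun f x => ∑ i ∈ Finset.range n,
    (deriv (c i) x * iteratedDeriv i f x + c i x * iteratedDeriv (i + 1) f x)) ?_
    (isDiffOpLTOn_sum _ (fun i f x => deriv (c i) x * iteratedDeriv i f x +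
      c i x * iteratedDeriv (i + 1) f x) fun i hi => ?_)
  · intro x hx f hf
    beta_reduce
    rw [(hT.eventuallyEq hU hx hf).deriv_eq, deriv_fun_sum fun i _ =>
      (((hc i).1 x hx).fun_mul (analyticAt_iteratedDeriv hf i)).differentiableAt]
    refine Finset.sum_congr rfl fun i _ => ?_
    rw [deriv_fun_mul ((hc i).1 x hx).differentiableAt
      (analyticAt_iteratedDeriv hf i).differentiableAt, iteratedDeriv_succ]
  · have := Finset.mem_range.mp hi
    exact (isDiffOpLTOn_mul_iteratedDeriv (hc i).deriv (by omega)).add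
      (isDiffOpLTOn_mul_iteratedDeriv (hc i) (by omega))

theorem IsMonicDiffOpOn.isDiffOpLTOn (hT : IsMonicDiffOpOn U n T) : IsDiffOpLTOn U (n + 1) T := by
  obtain ⟨S, hS, h⟩ := isMonicDiffOpOn_iff.mp hT
  refine h.isDiffOpLTOn (IsDiffOpLTOn.add ?_ (hS.mono (Nat.le_succ n)))
  simpa using isDiffOpLTOn_mul_iteratedDeriv (isCoeffOn_const U 1) (Nat.lt_succ_self n)

theorem IsMonicDiffOpOn.analyticAt (hT : IsMonicDiffOpOn U n T) (hU : IsOpen U) (hx : x ∈ U)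
    (hf : AnalyticAt ℂ f x) : AnalyticAt ℂ (T f) x :=
  hT.isDiffOpLTOn.analyticAt hU hx hf

theorem IsMonicDiffOpOn.congr (hT : IsMonicDiffOpOn U n T) (hx : x ∈ U) (hf : AnalyticAt ℂ f x)
    (hfg : f =ᶠ[𝓝 x] g) : T f x = T g x := by
  obtain ⟨c, -, h⟩ := hT
  rw [h x hx f hf, h x hx g (hf.congr hfg)]
  simp only [fun i => hfg.iteratedDeriv_eq i]

theorem OpEqOn.isMonicDiffOpOn (h : OpEqOn U S T) (hT : IsMonicDiffOpOn U n T) :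
    IsMonicDiffOpOn U n S := by
  obtain ⟨c, hc, hT⟩ := hT
  exact ⟨c, hc, h.trans hT⟩

theorem IsMonicDiffOpOn.add (hT : IsMonicDiffOpOn U n T) (hS : IsDiffOpLTOn U n S) :
    IsMonicDiffOpOn U n fun f x => T f x + S f x := by
  obtain ⟨R, hR, h⟩ := isMonicDiffOpOn_iff.mp hT
  refine isMonicDiffOpOn_iff.mpr ⟨_, hR.add hS, fun x hx f hf => ?_⟩
  simp only [h x hx f hf, add_assoc]

theorem IsMonicDiffOpOn.deriv_comp (hT : IsMonicDiffOpOn U n T) (hU : IsOpen U) :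
    IsMonicDiffOpOn U (n + 1) fun f => deriv (T f) := by
  obtain ⟨R, hR, h⟩ := isMonicDiffOpOn_iff.mp hT
  refine isMonicDiffOpOn_iff.mpr ⟨_, hR.deriv_comp hU, fun x hx f hf => ?_⟩
  beta_reduce
  rw [(h.eventuallyEq hU hx hf).deriv_eq, deriv_fun_add
    (analyticAt_iteratedDeriv hf n).differentiableAt (hR.analyticAt hU hx hf).differentiableAt,
    iteratedDeriv_succ]

theorem IsMonicDiffOpOn.iteratedDeriv_comp (hT : IsMonicDiffOpOn U n T) (hU : IsOpen U) (i : ℕ) :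
    IsMonicDiffOpOn U (i + n) fun f => iteratedDeriv i (T f) := by
  induction i with
  | zero => simpa using hT
  | succ i ih =>
    simp only [iteratedDeriv_succ]
    rw [show i + 1 + n = i + n + 1 by omega]
    exact ih.deriv_comp hU

theorem IsMonicDiffOpOn.comp (hS : IsMonicDiffOpOn U m S) (hT : IsMonicDiffOpOn U n T)
    (hU : IsOpen U) : IsMonicDiffOpOn U (m + n) (S ∘ T) := by
  obtain ⟨c, hc, h⟩ := hS
  refine OpEqOn.isMonicDiffOpOn (T := fun f x => iteratedDeriv m (T f) x +
    ∑ i : Fin m, c i x * iteratedDeriv i (T f) x)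
    (fun x hx f hf => h x hx (T f) (hT.analyticAt hU hx hf))
    ((hT.iteratedDeriv_comp hU m).add (isDiffOpLTOn_sum _
      (fun (i : Fin m) f x => c i x * iteratedDeriv i (T f) x) fun i _ =>
      ((hT.iteratedDeriv_comp hU i).isDiffOpLTOn.mono ?_).coeff_mul (hc i)))
  have := i.2
  omega

theorem isMonicDiffOpOn_id : IsMonicDiffOpOn U 0 id :=
  ⟨fun i => i.elim0, fun i => i.elim0, fun x _ f _ => by simp⟩

theorem isMonicDiffOpOn_deriv_add (hc : IsCoeffOn U c) :
    IsMonicDiffOpOn U 1 fun f x => deriv f x + c x * f x :=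
  ⟨fun _ => c, fun _ => hc, fun x _ f _ => by simp⟩

end

/-! ### Intertwining operators and their composition -/

section

variable {P : PeriodPair} {α : Fin 4 → ℤ} {x : ℂ} {f : ℂ → ℂ}

theorem isCoeffOn_derivWeierstrassP : IsCoeffOn (regularSet P) P.derivWeierstrassP :=
  ⟨fun _ hx => analyticAt_derivWeierstrassP hx, P.meromorphic_derivWeierstrassP⟩

theorem isCoeffOn_gaugeLog : IsCoeffOn (regularSet P) (gaugeLog P α) := by
  refine ⟨fun _ hx => analyticAt_gaugeLog hx, ?_⟩
  have h := P.meromorphic_weierstrassP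
  unfold gaugeLog
  fun_prop

/-- Each step composes on the left with the monic first-order operator d/dx - n ℘''/℘' - ℘' ·
`gaugeLog`: the factor ℘'^(n+1) cancels the 1/℘' in ∇. -/
theorem isMonicDiffOpOn_gaugePow (n : ℕ) :
    IsMonicDiffOpOn (regularSet P) n (gaugePow P α n) := by
  induction n with
  | zero =>
    refine OpEqOn.isMonicDiffOpOn (fun x _ f _ => ?_) isMonicDiffOpOn_id
    simp [gaugePow]
  | succ n ih =>
    have hq := isCoeffOn_derivWeierstrassP (P := P)
    have hc : IsCoeffOn (regularSet P) fun x => (-n : ℂ) * (deriv P.derivWeierstrassP x *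
        (P.derivWeierstrassP x)⁻¹) + (-1) * (P.derivWeierstrassP x * gaugeLog P α x) :=
      ((isCoeffOn_const _ _).mul (hq.deriv.mul (hq.inv fun x hx => derivWeierstrassP_ne hx))).add
        ((isCoeffOn_const _ _).mul (hq.mul isCoeffOn_gaugeLog))
    rw [add_comm]
    refine OpEqOn.isMonicDiffOpOn (fun x hx f hf => ?_)
      ((isMonicDiffOpOn_deriv_add hc).comp ih (isOpen_regularSet P))
    have hq' := (analyticAt_derivWeierstrassP hx).differentiableAt.hasDerivAt
    have hg := (analyticAt_gaugeDeriv_iterate (α := α) hx hf n).differentiableAt.hasDerivAt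
    have h0 := derivWeierstrassP_ne hx
    have hd : deriv (gaugePow P α n f) x = _ := ((hq'.fun_pow n).fun_mul hg).deriv
    have hn : (n : ℂ) * P.derivWeierstrassP x ^ (n - 1) =
        n * P.derivWeierstrassP x ^ n / P.derivWeierstrassP x := by
      cases n with
      | zero => simp
      | succ n => simp [pow_succ]; field_simp
    simp only [Function.comp]
    rw [hd, hn, gaugePow, gaugePow, add_comm 1 n, Function.iterate_succ_apply', gaugeDeriv]
    field_simp
    ring

theorem analyticAt_hamiltonian (hx : x ∈ regularSet P) (hf : AnalyticAt ℂ f x) (l : Fin 4 → ℤ) :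
    AnalyticAt ℂ (hamiltonian P l f) x := by
  refine hf.deriv.deriv.neg.add (AnalyticAt.mul (Finset.analyticAt_fun_sum _ fun i _ =>
    analyticAt_const.mul ?_) hf)
  exact (P.analyticOnNhd_weierstrassP _ (add_halfPeriod_notMem P hx i)).fun_comp
    (f := fun y => y + halfPeriod P i) (by fun_prop)

/-- `T` is a monic differential operator of order `n` with `T H^{(l)} = H^{(l')} T`. -/
structure Intertwines (P : PeriodPair) (n : ℕ) (l l' : Fin 4 → ℤ) (T : (ℂ → ℂ) → (ℂ → ℂ)) :
    Prop where
  monic : IsMonicDiffOpOn (regularSet P) n T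
  opEq : OpEqOn (regularSet P) (T ∘ hamiltonian P l) (hamiltonian P l' ∘ T)

theorem Intertwines.comp {m n : ℕ} {l l' l'' : Fin 4 → ℤ} {S T : (ℂ → ℂ) → (ℂ → ℂ)}
    (hS : Intertwines P m l' l'' S) (hT : Intertwines P n l l' T) :
    Intertwines P (m + n) l l'' (S ∘ T) := by
  refine ⟨hS.monic.comp hT.monic (isOpen_regularSet P), fun x hx f hf => ?_⟩
  have hTf := hT.monic.analyticAt (isOpen_regularSet P) hx hf
  have h1 := hT.opEq.eventuallyEq (isOpen_regularSet P) hx hf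
  have h2 := hS.opEq x hx (T f) hTf
  simp only [Function.comp] at h1 h2 ⊢
  rw [← h2]
  -- The relation for `T` holds in a neighbourhood of `x`, and `S`, being a differential operator,
  -- is local.
  exact (hS.monic.congr hx (analyticAt_hamiltonian hx hTf l') h1.symm).symm

theorem hamiltonian_congr {l l' : Fin 4 → ℤ} (h : ∀ i, l i * (l i + 1) = l' i * (l' i + 1)) :
    hamiltonian P l = hamiltonian P l' := by
  have h' (i : Fin 4) : (l i : ℂ) * ((l i : ℂ) + 1) = l' i * (l' i + 1) := by exact_mod_cast h i
  funext f x
  simp only [hamiltonian, h']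

theorem intertwines_darboux (m : ℕ) (hm : ∑ i, α i = -2 * m) (l l' : Fin 4 → ℤ)
    (hl : ∀ i, l i * (l i + 1) = α i * (α i - 1))
    (hl' : ∀ i, l' i * (l' i + 1) = (α i + m) * (α i + m + 1)) :
    Intertwines P (m + 1) l l' (darboux P α) := by
  have hd : (-(∑ i, α i) / 2).toNat = m := by omega
  have he : OpEqOn (regularSet P) (darboux P α) (gaugePow P α (m + 1)) := fun x hx f hf => by
    rw [darboux_eq_gaugePow hx hf, hd]
  have hM := he.isMonicDiffOpOn (isMonicDiffOpOn_gaugePow (m + 1))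
  refine ⟨hM, fun x hx f hf => ?_⟩
  have h1 := he.eventuallyEq (isOpen_regularSet P) hx hf
  have h2 : deriv (deriv (darboux P α f)) x = deriv (deriv (gaugePow P α (m + 1) f)) x :=
    h1.deriv.deriv_eq
  simp only [Function.comp]
  rw [he x hx _ (analyticAt_hamiltonian hx hf l), gaugePow_hamiltonian hx hf m hm l l' hl hl',
    hamiltonian, hamiltonian, h2, h1.eq_of_nhds]

/-- The operator `L̃_α` intertwines two Hamiltonians, for all `α` with even sum `2 s`. -/
theorem intertwines_darbouxTilde (s : ℤ) (hs : ∑ i, α i = 2 * s) (l l' : Fin 4 → ℤ)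
    (hl : ∀ i, α i = -l i ∨ α i = l i + 1)
    (hl' : ∀ i, α i - s = l' i ∨ α i - s = -l' i - 1) :
    Intertwines P (1 - s).natAbs l l' (darbouxTilde P α) := by
  have hev : Even (∑ i, α i) := ⟨s, by omega⟩
  have hdiv : (∑ i, α i) / 2 = s := by omega
  have hL (i : Fin 4) : l i * (l i + 1) = α i * (α i - 1) := by
    rcases hl i with h | h <;> (rw [h]; ring)
  have hL' (i : Fin 4) : l' i * (l' i + 1) = (α i - s) * (α i - s + 1) := by
    rcases hl' i with h | h
    · rw [h]
    · rw [h]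
      ring
  simp only [darbouxTilde, hev, hdiv, true_and]
  split_ifs with h1 h2
  · rw [show (1 - s).natAbs = (-s).toNat + 1 by omega]
    have hm : ((-s).toNat : ℤ) = -s := by omega
    refine intertwines_darboux _ (by omega) l l' hL fun i => ?_
    rw [hL', hm]
    ring
  -- The exponents 1 - α_i have sum -2(s - 2) and give the same α_i(α_i - 1). The target (1 - α_i) +
  -- (s - 2) equals -(α_i - s) - 1, which defines the same Hamiltonian.
  · rw [show (1 - s).natAbs = (s - 2).toNat + 1 by omega]
    have hm : ((s - 2).toNat : ℤ) = s - 2 := by omega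
    refine intertwines_darboux _ ?_ l l' (fun i => ?_) fun i => ?_
    · rw [Fin.sum_univ_four] at hs ⊢
      omega
    · rw [hL]
      ring
    · rw [hL', hm]
      ring
  -- Here l'_i is α_i - 1 or -α_i, so both Hamiltonians have coefficients α_i(α_i - 1) and the
  -- identity intertwines them.
  · obtain rfl : s = 1 := by omega
    refine ⟨isMonicDiffOpOn_id, fun x _ f _ => ?_⟩
    simp only [Function.comp, id]
    rw [hamiltonian_congr fun i => ?_]
    rw [hL, hL']
    ring

end

end

/-! ### The order 2g + 1 and the closed chain -/

section

/-- The three terms correspond to the three splittings of four indices into two pairs, which a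
permutation only permutes. -/
theorem sum_abs_comp_perm (l : Fin 4 → ℕ) (σ : Equiv.Perm (Fin 4)) :
    |(l (σ 0) + l (σ 1) - l (σ 2) - l (σ 3) : ℤ)| + |(l (σ 0) - l (σ 1) + l (σ 2) - l (σ 3) : ℤ)| +
      |(l (σ 0) - l (σ 1) - l (σ 2) + l (σ 3) : ℤ)| =
    |(l 0 + l 1 - l 2 - l 3 : ℤ)| + |(l 0 - l 1 + l 2 - l 3 : ℤ)| +
      |(l 0 - l 1 - l 2 + l 3 : ℤ)| := by
  induction σ using Equiv.Perm.swap_induction_on' with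
  | one => rfl
  | mul_swap σ i j hij ih =>
    rw [← ih]
    simp only [Equiv.Perm.mul_apply]
    clear ih
    fin_cases i <;> fin_cases j <;> simp [Equiv.swap_apply_def] <;> grind

theorem descSort_antitone (l : Fin 4 → ℕ) :
    descSort l 1 ≤ descSort l 0 ∧ descSort l 2 ≤ descSort l 1 ∧ descSort l 3 ≤ descSort l 2 := by
  have h := Tuple.monotone_sort l
  exact ⟨h (by decide), h (by decide), h (by decide)⟩

theorem sum_comp_descSort (l : Fin 4 → ℕ) (F : ℕ → ℤ) :
    F (descSort l 0) + F (descSort l 1) + F (descSort l 2) + F (descSort l 3) =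
      F (l 0) + F (l 1) + F (l 2) + F (l 3) := by
  have h := Equiv.sum_comp (Fin.revPerm.trans (Tuple.sort l)) fun i => F (l i)
  rw [Fin.sum_univ_four, Fin.sum_univ_four] at h
  exact h

/-- The first three orders are half the absolute values in `sum_abs_comp_perm`, so l may be sorted.
Then only k_0 - k_1 - k_2 + k_3 has an undetermined sign, which is the case split in g. -/
theorem genus_even {l : Fin 4 → ℕ} {t : ℤ} (ht : (l 0 + l 1 + l 2 + l 3 : ℤ) = 2 * t) :
    (1 + l 0 + l 3 - t - 1).natAbs + ((1 + l 0 + l 2 - t - 1).natAbs +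
      ((1 + t - l 2 - l 3 - 1).natAbs + (-t - 1).natAbs)) = 2 * genus l + 1 := by
  have hs := sum_comp_descSort l fun n => n
  have ha : |(descSort l 0 + descSort l 1 - descSort l 2 - descSort l 3 : ℤ)| +
      |(descSort l 0 - descSort l 1 + descSort l 2 - descSort l 3 : ℤ)| +
      |(descSort l 0 - descSort l 1 - descSort l 2 + descSort l 3 : ℤ)| = _ :=
    sum_abs_comp_perm l (Fin.revPerm.trans (Tuple.sort l))
  obtain ⟨h1, h2, h3⟩ := descSort_antitone l
  have hev : Even (∑ i, l i) := by
    rw [Fin.sum_univ_four, Nat.even_iff]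
    omega
  simp only [genus, hev, if_true]
  generalize descSort l 0 = k₀, descSort l 1 = k₁, descSort l 2 = k₂, descSort l 3 = k₃ at *
  simp only [Int.abs_eq_natAbs] at ha
  split_ifs <;> omega

/-- The sum is visibly symmetric. After sorting, k_1 ≤ t, so only the sign of 1 - (k_0 - t) is
undetermined. -/
theorem genus_odd {l : Fin 4 → ℕ} {t : ℤ} (ht : (l 0 + l 1 + l 2 + l 3 : ℤ) = 2 * t + 1) :
    (1 - (l 2 - t)).natAbs + ((1 - (l 3 - t)).natAbs + ((1 - (l 1 - t)).natAbs +
      (1 - (l 0 - t)).natAbs)) = 2 * genus l + 1 := by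
  have hs := sum_comp_descSort l fun n => n
  have ha := sum_comp_descSort l fun n => ((1 - (n - t)).natAbs : ℤ)
  obtain ⟨h1, h2, h3⟩ := descSort_antitone l
  have hev : ¬ Even (∑ i, l i) := by
    rw [Fin.sum_univ_four, Nat.even_iff]
    omega
  simp only [genus, hev, if_false]
  generalize descSort l 0 = k₀, descSort l 1 = k₁, descSort l 2 = k₂, descSort l 3 = k₃ at *
  split_ifs <;> omega

/-- For even sum the parameters run through l, l^e, (l_1, l_0, l_3, l_2), (l_3^e, l_2^e, l_1^e,
l_0^e) and back to l. For odd sum the fourth stage is (l_2^o, l_3^o, l_0^o, l_1^o). Intermediate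
entries may be negative and matter only up to k ↦ -k - 1. -/
theorem intertwines_commutingOp (P : PeriodPair) (l : Fin 4 → ℕ) :
    Intertwines P (2 * genus l + 1) (fun i => l i) (fun i => l i) (commutingOp P l) := by
  have h01 : (∑ i, l i) = l 0 + l 1 + l 2 + l 3 := Fin.sum_univ_four l
  by_cases hev : Even (∑ i, l i)
  · obtain ⟨t, ht⟩ : ∃ t : ℤ, (l 0 + l 1 + l 2 + l 3 : ℤ) = 2 * t := by
      obtain ⟨t, ht⟩ := hev
      exact ⟨t, by omega⟩
    have he : lEven l = ![t - l 0, t - l 1, t - l 2, t - l 3] := by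
      funext i
      fin_cases i <;> simp [lEven] <;> omega
    have e1 : Intertwines P (1 - -t).natAbs (fun i => l i) (lEven l)
        (darbouxTilde P ![-l 0, -l 1, -l 2, -l 3]) := by
      refine intertwines_darbouxTilde _ ?_ _ _ ?_ ?_
      · simp [Fin.sum_univ_four]; omega
      · intro i; fin_cases i <;> simp
      · intro i; fin_cases i <;> simp [he] <;> omega
    have e2 : Intertwines P (1 - (1 + t - l 2 - l 3)).natAbs (lEven l) ![l 1, l 0, l 3, l 2]
        (darbouxTilde P ![-lEven l 0, -lEven l 1, lEven l 2 + 1, lEven l 3 + 1]) := by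
      refine intertwines_darbouxTilde _ ?_ _ _ ?_ ?_
      · simp [Fin.sum_univ_four, he]; omega
      · intro i; fin_cases i <;> simp
      · intro i; fin_cases i <;> simp [he] <;> omega
    have e3 : Intertwines P (1 - (1 + l 0 + l 2 - t)).natAbs ![l 1, l 0, l 3, l 2]
        ![lEven l 3, lEven l 2, lEven l 1, lEven l 0]
        (darbouxTilde P ![-l 1, l 0 + 1, -l 3, l 2 + 1]) := by
      refine intertwines_darbouxTilde _ ?_ _ _ ?_ ?_
      · simp [Fin.sum_univ_four]; omega
      · intro i; fin_cases i <;> simp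
      · intro i; fin_cases i <;> simp [he] <;> omega
    have e4 : Intertwines P (1 - (1 + l 0 + l 3 - t)).natAbs
        ![lEven l 3, lEven l 2, lEven l 1, lEven l 0] (fun i => l i)
        (darbouxTilde P ![-lEven l 3, lEven l 2 + 1, lEven l 1 + 1, -lEven l 0]) := by
      refine intertwines_darbouxTilde _ ?_ _ _ ?_ ?_
      · simp [Fin.sum_univ_four, he]; omega
      · intro i; fin_cases i <;> simp
      · intro i; fin_cases i <;> simp [he] <;> omega
    rw [commutingOp, if_pos hev, ← genus_even ht]
    convert e4.comp (e3.comp (e2.comp e1)) using 1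
    omega
  · obtain ⟨t, ht⟩ : ∃ t : ℤ, (l 0 + l 1 + l 2 + l 3 : ℤ) = 2 * t + 1 := by
      obtain ⟨t, ht⟩ := Nat.not_even_iff_odd.mp hev
      exact ⟨t, by omega⟩
    have he : lOdd l = ![t + 1, l 0 + l 1 - t - 1, l 0 + l 2 - t - 1, l 0 + l 3 - t - 1] := by
      funext i
      fin_cases i <;> simp [lOdd] <;> omega
    have e1 : Intertwines P (1 - (l 0 - t)).natAbs (fun i => l i) (lOdd l)
        (darbouxTilde P ![l 0 + 1, -l 1, -l 2, -l 3]) := by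
      refine intertwines_darbouxTilde _ ?_ _ _ ?_ ?_
      · simp [Fin.sum_univ_four]; omega
      · intro i; fin_cases i <;> simp
      · intro i; fin_cases i <;> simp [he] <;> omega
    have e2 : Intertwines P (1 - (l 1 - t)).natAbs (lOdd l) ![l 1, l 0, l 3, l 2]
        (darbouxTilde P ![-lOdd l 0, lOdd l 1 + 1, -lOdd l 2, -lOdd l 3]) := by
      refine intertwines_darbouxTilde _ ?_ _ _ ?_ ?_
      · simp [Fin.sum_univ_four, he]; omega
      · intro i; fin_cases i <;> simp
      · intro i; fin_cases i <;> simp [he] <;> omega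
    have e3 : Intertwines P (1 - (l 3 - t)).natAbs ![l 1, l 0, l 3, l 2]
        ![lOdd l 2, lOdd l 3, lOdd l 0, lOdd l 1]
        (darbouxTilde P ![-l 1, -l 0, l 3 + 1, -l 2]) := by
      refine intertwines_darbouxTilde _ ?_ _ _ ?_ ?_
      · simp [Fin.sum_univ_four]; omega
      · intro i; fin_cases i <;> simp
      · intro i; fin_cases i <;> simp [he] <;> omega
    have e4 : Intertwines P (1 - (l 2 - t)).natAbs
        ![lOdd l 2, lOdd l 3, lOdd l 0, lOdd l 1] (fun i => l i)
        (darbouxTilde P ![lOdd l 2 + 1, -lOdd l 3, -lOdd l 0, -lOdd l 1]) := by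
      refine intertwines_darbouxTilde _ ?_ _ _ ?_ ?_
      · simp [Fin.sum_univ_four, he]; omega
      · intro i; fin_cases i <;> simp
      · intro i; fin_cases i <;> simp [he] <;> omega
    rw [commutingOp, if_neg hev, ← genus_odd ht]
    exact e4.comp (e3.comp (e2.comp e1))

end

end Inozemtsev

end

theorem mainTheorem3 (P : PeriodPair) (l : Fin 4 → ℕ) :
    Inozemtsev.OpEqOn (Inozemtsev.regularSet P)
        (Inozemtsev.commutingOp P l ∘ Inozemtsev.hamiltonian P (fun i => (l i : ℤ)))
        (Inozemtsev.hamiltonian P (fun i => (l i : ℤ)) ∘ Inozemtsev.commutingOp P l) ∧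
      Inozemtsev.IsMonicDiffOpOn (Inozemtsev.regularSet P) (2 * Inozemtsev.genus l + 1)
        (Inozemtsev.commutingOp P l) :=
  ⟨(Inozemtsev.intertwines_commutingOp P l).opEq, (Inozemtsev.intertwines_commutingOp P l).monic⟩
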